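/- Let $\mathcal H_{\mathcal A}$ be a Hilbert space of finite dimension $d\ge 1$. An observable $A=\sum_a a\,|a\rangle\langle a|$ on $\mathcal H_{\mathcal A}$ has $d$ distinct real eigenvalues and an orthonormal eigenbasis. For a state (density operator) $\rho$ on $\mathcal H_{\mathcal A}\otimes\mathcal H_{\mathcal B}$, with $\mathcal H_{\mathcal B}$ finite-dimensional, put $\Phi_A(\rho)=\sum_a(|a\rangle\langle a|\otimes 1)\rho(|a\rangle\langle a|\otimes 1)$ and $\mathcal M_A^\epsilon(\rho)=(1-\epsilon)\rho+\epsilon\Phi_A(\rho)$. Let $\|X\|_p=(\operatorname{Tr}|X|^p)^{1/p}$, $d_p(\rho,\sigma)=\|\sigma-\rho\|_p$, $d_{Tr}=d_1$, $d_{HS}=d_2$, $F(\rho,\sigma)=\|\sqrt\sigma\sqrt\rho\|_1^2$, $d_{Bu}(\rho,\sigma)=(2-2\sqrt{F(\rho,\sigma)})^{1/2}$ and $d_{He}(\rho,\sigma)=\|\sqrt\sigma-\sqrt\rho\|_2$. Consider the losses $$L_A^{Bu}(\rho)=d^{-1/2}d_{Bu}^2(\rho,\Phi_A(\rho)),\qquad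 L_A^{He}(\rho)=d^{-1/2}d_{He}^2(\rho,\Phi_A(\rho)),$$ $$L_A^{Tr}(\rho)=d_{Tr}\big(\rho,\tfrac1d\Phi_A(\rho)\big)-\tfrac{d-1}{d},\qquad L_A^{HS}(\rho)=\tfrac1d\,d_{HS}^2(\rho,\Phi_A(\rho)),$$ $$L_A^{p}(\rho)=d_p^p\big(\rho\otimes|e_0\rangle\langle e_0|,\Phi_A(\rho)\otimes\tfrac{1}{d}1_{\mathcal E}\big)-d_p^p\big(\rho\otimes|e_0\rangle\langle e_0|,\rho\otimes\tfrac{1}{d}1_{\mathcal E}\big)\quad(1<p<\infty,\ p\ne 2),$$ where $\mathcal H_{\mathcal E}$ has dimension $d$ and orthonormal basis vector $e_0$. For each of them let $\mathfrak R^{\max}$ be the supremum of $L_A(\rho)$ over all observables $A$ on $\mathcal H_{\mathcal A}$, all finite-dimensional $\mathcal H_{\mathcal B}$ and all states $\rho$, and let $\mathfrak R_A(\rho)=\mathfrak R^{\max}-L_A(\rho)$. (I) Both $\mathfrak R=\mathfrak R^{Bu}$ and $\mathfrak R=\mathfrak R^{He}$ satisfy, for all observables and states: * Axiom 1: $0\le\mathfrak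 R_A(\rho)\le\mathfrak R_A(\mathcal M_A^\epsilon(\rho))\le\mathfrak R_A(\Phi_A(\rho))=\mathfrak R^{\max}$ for $0\le\epsilon\le1$, and $\mathfrak R_A(\rho)=\mathfrak R^{\max}$ if and only if $\rho=\Phi_A(\rho)$. * Axiom 2(a): $\mathfrak R_A(\operatorname{Tr}_{\mathcal X}\rho)\ge\mathfrak R_A(\rho)$ for a tensor factor $\mathcal X$ of $\mathcal B$. * Axiom 2(b): $\mathfrak R_A(\rho\otimes\sigma)=\mathfrak R_A(\rho)$ for every state $\sigma$ of an additional system. * Axiom 3: $\mathfrak R_X(\rho)+\mathfrak R_Y(\rho)\le2\mathfrak R^{\max}$ for any two observables $X,Y$ on $\mathcal H_{\mathcal A}$, with equality if and only if $\rho=\Phi_X(\rho)=\Phi_Y(\rho)$. Equality holds if $\rho=\frac1d1_{\mathcal A}\otimes\rho_{\mathcal B}$. If $d=2$, or if $X$ and $Y$ have no common invariant subspace other than $0$ and $\mathcal H_{\mathcal A}$, then equality holds only when $[X,Y]=0$ or $\rho=\frac1d1_{\mathcal A}\otimes\rho_{\mathcal B}$. * Axiom 4: $\mathfrak R_A(\sum_ip_i\rho_i)\ge\sum_ip_i\mathfrak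 R_A(\rho_i)$ for every finite ensemble $\{p_i,\rho_i\}$. (II) For Bures and for Hellinger, $\mathfrak R^{\max}=\frac{2}{\sqrt d}\big(1-\frac1{\sqrt d}\big)$, and for every observable $A$ this value is the loss $L_A$ of the maximally entangled state of $\mathcal H_{\mathcal A}\otimes\mathcal H_{\mathcal A}$. (III) If $d\ge2$, the quantifiers of the other distances are not monotones: $\mathfrak R^{Tr}$ violates Axiom 1 (its maximum is also reached at states with $\rho\ne\Phi_A(\rho)$), and $\mathfrak R^{HS}$ and every $\mathfrak R^{p}$ ($1<p<\infty$, $p\neq2$) violate Axiom 2(b). -/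

import Mathlib

open scoped Kronecker ComplexOrder

namespace QRealism

noncomputable section

/-- A density matrix on the finite-dimensional Hilbert space with orthonormal basis `n`. -/
def IsState {n : Type} [Fintype n] (ρ : Matrix n n ℂ) : Prop :=
  ρ.PosSemidef ∧ ρ.trace = 1

/-- Square root of a positive semidefinite matrix. -/
def msqrt {n : Type} [Fintype n] [DecidableEq n] (M : Matrix n n ℂ) : Matrix n n ℂ :=
  cfc Real.sqrt M

/-- The modulus `|M| = √(M† M)`. -/
def mabs {n : Type} [Fintype n] [DecidableEq n] (M : Matrix n n ℂ) : Matrix n n ℂ :=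
  msqrt (M.conjTranspose * M)

/-- The Schatten norm `‖M‖_p = (Tr |M|^p)^(1/p)`. -/
def schattenNorm {n : Type} [Fintype n] [DecidableEq n] (p : ℝ) (M : Matrix n n ℂ) : ℝ :=
  ((cfc (fun x : ℝ => x ^ p) (mabs M)).trace.re) ^ (1 / p)

/-- The Schatten distance `d_p(ρ, σ) = ‖σ - ρ‖_p`. -/
def dSchatten {n : Type} [Fintype n] [DecidableEq n] (p : ℝ) (ρ σ : Matrix n n ℂ) : ℝ :=
  schattenNorm p (σ - ρ)

/-- The Uhlmann fidelity `F(ρ, σ) = ‖√σ √ρ‖₁²`. -/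
def fidelity {n : Type} [Fintype n] [DecidableEq n] (ρ σ : Matrix n n ℂ) : ℝ :=
  schattenNorm 1 (msqrt σ * msqrt ρ) ^ 2

/-- The Bures distance. -/
def dBures {n : Type} [Fintype n] [DecidableEq n] (ρ σ : Matrix n n ℂ) : ℝ :=
  Real.sqrt (2 - 2 * Real.sqrt (fidelity ρ σ))

/-- The quantum Hellinger distance. -/
def dHellinger {n : Type} [Fintype n] [DecidableEq n] (ρ σ : Matrix n n ℂ) : ℝ :=
  schattenNorm 2 (msqrt σ - msqrt ρ)

/-- An observable with `d` distinct outcomes on a `d`-dimensional space: an orthonormal basis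
(the columns of a unitary matrix) together with pairwise distinct real eigenvalues. -/
structure Observable (a : Type) [Fintype a] [DecidableEq a] where
  basis : Matrix.unitaryGroup a ℂ
  value : a → ℝ
  value_injective : Function.Injective value

/-- The rank-one projector `|k⟩⟨k|` onto the `k`-th eigenvector. -/
def Observable.proj {a : Type} [Fintype a] [DecidableEq a] (A : Observable a) (k : a) :
    Matrix a a ℂ :=
  Matrix.of fun i j => (A.basis : Matrix a a ℂ) i k * star ((A.basis : Matrix a a ℂ) j k)

/-- The Hermitian matrix `∑ₖ (value k) |k⟩⟨k|`. -/
def Observable.toMatrix {a : Type} [Fintype a] [DecidableEq a] (A : Observable a) :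
    Matrix a a ℂ :=
  ∑ k, (A.value k : ℂ) • A.proj k

/-- The non-selective projective measurement
`Φ_A(ρ) = ∑ₖ (A_k ⊗ 1) ρ (A_k ⊗ 1)` on `H_A ⊗ H_B`. -/
def measure {a b : Type} [Fintype a] [DecidableEq a] [Fintype b] [DecidableEq b]
    (A : Observable a) (ρ : Matrix (a × b) (a × b) ℂ) : Matrix (a × b) (a × b) ℂ :=
  ∑ k, (A.proj k ⊗ₖ (1 : Matrix b b ℂ)) * ρ * (A.proj k ⊗ₖ (1 : Matrix b b ℂ))

/-- The monitoring map `(1 - ε) ρ + ε Φ_A(ρ)`. -/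
def monitor {a b : Type} [Fintype a] [DecidableEq a] [Fintype b] [DecidableEq b]
    (A : Observable a) (ε : ℝ) (ρ : Matrix (a × b) (a × b) ℂ) : Matrix (a × b) (a × b) ℂ :=
  ((1 - ε : ℝ) : ℂ) • ρ + (ε : ℂ) • measure A ρ

/-- The partial trace over the last factor of `H_A ⊗ (H_B ⊗ H_X)`. -/
def traceOut {a b x : Type} [Fintype x] (ρ : Matrix (a × b × x) (a × b × x) ℂ) :
    Matrix (a × b) (a × b) ℂ :=
  Matrix.of fun i j => ∑ k, ρ (i.1, i.2, k) (j.1, j.2, k)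

/-- The reduced state on `H_B` of a state on `H_A ⊗ H_B`. -/
def reducedB {a b : Type} [Fintype a] (ρ : Matrix (a × b) (a × b) ℂ) : Matrix b b ℂ :=
  Matrix.of fun i j => ∑ k, ρ (k, i) (k, j)

/-- `ρ ⊗ σ`, regarded as a state on `H_A ⊗ (H_B ⊗ H_C)`. -/
def adjoin {a b c : Type} (ρ : Matrix (a × b) (a × b) ℂ) (σ : Matrix c c ℂ) :
    Matrix (a × b × c) (a × b × c) ℂ :=
  Matrix.reindex (Equiv.prodAssoc a b c) (Equiv.prodAssoc a b c) (ρ ⊗ₖ σ)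

/-- The density matrix of `d^(-1/2) ∑ₖ |k⟩|k⟩` in `H_A ⊗ H_A`. -/
def maxEntangled (a : Type) [Fintype a] [DecidableEq a] : Matrix (a × a) (a × a) ℂ :=
  Matrix.of fun i j => if i.1 = i.2 ∧ j.1 = j.2 then (Fintype.card a : ℂ)⁻¹ else 0

/-- A real functional of an observable on a fixed `H_A` and an operator on `H_A ⊗ H_B`, for all
finite-dimensional `H_B`. -/
abbrev Quantifier (a : Type) [Fintype a] [DecidableEq a] : Type 1 :=
  ∀ (b : Type) [Fintype b] [DecidableEq b], Observable a → Matrix (a × b) (a × b) ℂ → ℝ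

section Quantifiers

variable (a : Type) [Fintype a] [DecidableEq a]

/-- `d_E^(-1/2) d_Bu²(ρ, Φ_A(ρ))`, where `d_E = d_A`. -/
def lossBures : Quantifier a := fun _ _ _ A ρ =>
  1 / Real.sqrt (Fintype.card a) * dBures ρ (measure A ρ) ^ 2

/-- `d_E^(-1/2) d_He²(ρ, Φ_A(ρ))`. -/
def lossHellinger : Quantifier a := fun _ _ _ A ρ =>
  1 / Real.sqrt (Fintype.card a) * dHellinger ρ (measure A ρ) ^ 2

/-- `d_Tr(ρ, Φ_A(ρ)/d_E) - (d_E - 1)/d_E`. -/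
def lossTrace : Quantifier a := fun _ _ _ A ρ =>
  dSchatten 1 ρ ((Fintype.card a : ℂ)⁻¹ • measure A ρ)
    - ((Fintype.card a : ℝ) - 1) / (Fintype.card a : ℝ)

/-- `d_E^(-1) d_HS²(ρ, Φ_A(ρ))`. -/
def lossHilbertSchmidt : Quantifier a := fun _ _ _ A ρ =>
  1 / (Fintype.card a : ℝ) * dSchatten 2 ρ (measure A ρ) ^ 2

/-- The increase of conditional information for `d_p^p`: the difference of
`d_p^p(ρ ⊗ |e₀⟩⟨e₀|, Φ_A(ρ) ⊗ 1/d_E)` and `d_p^p(ρ ⊗ |e₀⟩⟨e₀|, ρ ⊗ 1/d_E)`, with `ρ` and `e₀`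
acting on `H_A ⊗ H_B` and on the environment `H_E`, a copy of `H_A`. -/
def lossSchatten (p : ℝ) (e₀ : a) : Quantifier a := fun _ _ _ A ρ =>
  dSchatten p (ρ ⊗ₖ Matrix.single e₀ e₀ (1 : ℂ))
      (measure A ρ ⊗ₖ ((Fintype.card a : ℂ)⁻¹ • (1 : Matrix a a ℂ))) ^ p
    - dSchatten p (ρ ⊗ₖ Matrix.single e₀ e₀ (1 : ℂ))
      (ρ ⊗ₖ ((Fintype.card a : ℂ)⁻¹ • (1 : Matrix a a ℂ))) ^ p

variable {a}

/-- The maximal realism: the largest loss over all observables on `H_A`, all `H_B` and all states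
on `H_A ⊗ H_B`. -/
def maxRealism (L : Quantifier a) : ℝ :=
  sSup {r : ℝ | ∃ (m : ℕ) (A : Observable a) (ρ : Matrix (a × Fin m) (a × Fin m) ℂ),
    IsState ρ ∧ r = L (Fin m) A ρ}

/-- The realism `R_A(ρ) = R^max - L_A(ρ)`. -/
def realism (L : Quantifier a) : Quantifier a := fun b _ _ A ρ =>
  maxRealism L - L b A ρ

/-- Realism and measurements. The maximum is reached exactly at the states that already have
realism for the observable. -/
def MeasurementAxiom (R : Quantifier a) (Rmax : ℝ) : Prop :=
  ∀ (b : Type) [Fintype b] [DecidableEq b] (A : Observable a)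
    (ρ : Matrix (a × b) (a × b) ℂ), IsState ρ →
    (∀ ε : ℝ, 0 ≤ ε → ε ≤ 1 →
      0 ≤ R b A ρ ∧ R b A ρ ≤ R b A (monitor A ε ρ) ∧
      R b A (monitor A ε ρ) ≤ R b A (measure A ρ)) ∧
    R b A (measure A ρ) = Rmax ∧
    (R b A ρ = Rmax ↔ measure A ρ = ρ)

/-- Discarding a subsystem does not reduce realism. -/
def DiscardAxiom (R : Quantifier a) : Prop :=
  ∀ (b x : Type) [Fintype b] [DecidableEq b] [Fintype x] [DecidableEq x] (A : Observable a)
    (ρ : Matrix (a × b × x) (a × b × x) ℂ), IsState ρ →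
    R (b × x) A ρ ≤ R b A (traceOut ρ)

/-- Adding an uncorrelated system does not change realism. -/
def UncorrelatedAxiom (R : Quantifier a) : Prop :=
  ∀ (b c : Type) [Fintype b] [DecidableEq b] [Fintype c] [DecidableEq c] (A : Observable a)
    (ρ : Matrix (a × b) (a × b) ℂ) (σ : Matrix c c ℂ), IsState ρ → IsState σ →
    R (b × c) A (adjoin ρ σ) = R b A ρ

/-- The state is maximally mixed on `H_A` and uncorrelated: `ρ = 1/d_A ⊗ ρ_B`. -/
def IsMixedOnA {b : Type} (ρ : Matrix (a × b) (a × b) ℂ) : Prop :=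
  ρ = ((Fintype.card a : ℂ)⁻¹ • (1 : Matrix a a ℂ)) ⊗ₖ reducedB ρ

/-- `X` and `Y` have no common invariant subspace other than `0` and `H_A`: an orthogonal
projection commuting with both is trivial. -/
def NoCommonBlock (X Y : Observable a) : Prop :=
  ∀ P : Matrix a a ℂ, P.IsHermitian → P * P = P →
    Commute P X.toMatrix → Commute P Y.toMatrix → P = 0 ∨ P = 1

/-- Uncertainty relation, with its cases of equality. -/
def UncertaintyAxiom (R : Quantifier a) (Rmax : ℝ) : Prop :=
  ∀ (b : Type) [Fintype b] [DecidableEq b] (X Y : Observable a)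
    (ρ : Matrix (a × b) (a × b) ℂ), IsState ρ →
    R b X ρ + R b Y ρ ≤ 2 * Rmax ∧
    (R b X ρ + R b Y ρ = 2 * Rmax ↔ measure X ρ = ρ ∧ measure Y ρ = ρ) ∧
    (IsMixedOnA ρ → R b X ρ + R b Y ρ = 2 * Rmax) ∧
    (Fintype.card a = 2 ∨ NoCommonBlock X Y → R b X ρ + R b Y ρ = 2 * Rmax →
      Commute X.toMatrix Y.toMatrix ∨ IsMixedOnA ρ)

/-- Realism is concave. -/
def MixingAxiom (R : Quantifier a) : Prop :=
  ∀ (b : Type) [Fintype b] [DecidableEq b] (A : Observable a) (ι : Type) [Fintype ι]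
    (p : ι → ℝ) (ρ : ι → Matrix (a × b) (a × b) ℂ),
    (∀ i, 0 ≤ p i) → ∑ i, p i = 1 → (∀ i, IsState (ρ i)) →
    ∑ i, p i * R b A (ρ i) ≤ R b A (∑ i, (p i : ℂ) • ρ i)

/-- All axioms of a monotone of violations of quantum realism. -/
structure IsMonotone (R : Quantifier a) (Rmax : ℝ) : Prop where
  measurement : MeasurementAxiom R Rmax
  discard : DiscardAxiom R
  uncorrelated : UncorrelatedAxiom R
  uncertainty : UncertaintyAxiom R Rmax
  mixing : MixingAxiom R

end Quantifiers

end

end QRealism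

/-!
The affinity `Tr √ρ √σ` and the square root of the fidelity are monotone under partial traces and
additive on direct sums, hence concave. The Hellinger and the Bures loss are
`2 d^(-1/2) (1 - f(ρ, Φ_A(ρ)))` for these two functions `f`, and everything claimed about them
follows from such properties of `f`. The sharp bound `f(ρ, Φ_A(ρ)) ≥ d^(-1/2)` comes from the
pinching inequality `ρ ≤ d Φ_A(ρ)`, and the maximally entangled state attains it for every `A`.
Equality in the uncertainty relation means that the blocks `⟨i|ρ|j⟩` over `H_B` commute with both
observables, so that without a common invariant subspace they are scalar.

The trace loss vanishes whenever `ρ ≥ Φ_A(ρ) / d`, and this holds for suitable monitored states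
that are not fixed by `Φ_A`. Adjoining a maximally mixed state `τ` multiplies the Hilbert–Schmidt
loss and the `p`-loss by `‖τ‖_p^p ≠ 1`, which violates Axiom 2(b) as soon as the loss does not
vanish identically. For the `p`-loss this is seen on monitored maximally entangled states, as a
function of the monitoring strength.
-/

namespace QRealism

noncomputable section

open Matrix
open scoped MatrixOrder

section Order

variable {m n : Type*}

theorem conjTranspose_mul_self_nonneg [Fintype m] [Finite n] (A : Matrix m n ℂ) : 0 ≤ Aᴴ * A :=
  (posSemidef_conjTranspose_mul_self A).nonneg

theorem ofReal_smul_nonneg {M : Matrix n n ℂ} (hM : 0 ≤ M) {c : ℝ} (hc : 0 ≤ c) :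
    0 ≤ (c : ℂ) • M :=
  (hM.posSemidef.smul (by exact_mod_cast hc)).nonneg

theorem kronecker_nonneg [Finite m] [Finite n] {M : Matrix m m ℂ} {N : Matrix n n ℂ}
    (hM : 0 ≤ M) (hN : 0 ≤ N) : 0 ≤ M ⊗ₖ N := by
  have := Fintype.ofFinite m
  have := Fintype.ofFinite n
  exact (hM.posSemidef.kronecker hN.posSemidef).nonneg

variable [Fintype n]

theorem conjTranspose_mul_mul_mono [Finite m] {M N : Matrix n n ℂ} (h : M ≤ N)
    (C : Matrix n m ℂ) : Cᴴ * M * C ≤ Cᴴ * N * C := by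
  have hC := PosSemidef.conjTranspose_mul_mul_same (le_iff.1 h) C
  rwa [Matrix.mul_sub, Matrix.sub_mul, ← le_iff] at hC

open scoped Matrix.Norms.L2Operator in
theorem le_of_mul_self_le {H K : Matrix n n ℂ} (hH : H.IsHermitian) (hK : 0 ≤ K)
    (h : H * H ≤ K * K) : H ≤ K := by
  classical
  have hle_abs : H ≤ CFC.abs H := by
    rw [← sub_nonneg, CFC.abs_sub_self H hH, two_nsmul]
    exact add_nonneg (CFC.negPart_nonneg H) (CFC.negPart_nonneg H)
  calc H ≤ CFC.abs H := hle_abs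
    _ = CFC.sqrt (H * H) := by rw [CFC.abs, star_eq_conjTranspose, hH.eq]
    _ ≤ CFC.sqrt (K * K) := CFC.sqrt_le_sqrt _ _ h
    _ = K := CFC.sqrt_unique rfl hK

theorem re_trace_nonneg {M : Matrix n n ℂ} (hM : 0 ≤ M) : 0 ≤ M.trace.re :=
  (Complex.le_def.1 hM.posSemidef.trace_nonneg).1

theorem re_trace_mono {M N : Matrix n n ℂ} (h : M ≤ N) : M.trace.re ≤ N.trace.re := by
  have hs := re_trace_nonneg (sub_nonneg.2 h)
  rwa [trace_sub, Complex.sub_re, sub_nonneg] at hs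

theorem eq_zero_of_re_trace_eq_zero {M : Matrix n n ℂ} (hM : 0 ≤ M) (h : M.trace.re = 0) :
    M = 0 :=
  hM.posSemidef.trace_eq_zero_iff.1
    (Complex.ext h (Complex.le_def.1 hM.posSemidef.trace_nonneg).2.symm)

theorem re_trace_conjTranspose (M : Matrix n n ℂ) : Mᴴ.trace.re = M.trace.re := by
  rw [trace_conjTranspose, Complex.star_def, Complex.conj_re]

theorem re_trace_ofReal_smul (c : ℝ) (M : Matrix n n ℂ) :
    ((c : ℂ) • M).trace.re = c * M.trace.re := by
  rw [trace_smul, smul_eq_mul, Complex.re_ofReal_mul]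

theorem trace_submatrix_equiv [Fintype m] (M : Matrix n n ℂ) (e : m ≃ n) :
    (M.submatrix e e).trace = M.trace :=
  e.sum_comp fun i => M i i

end Order

section Roots

variable {m n : Type} [Fintype m] [DecidableEq m] [Fintype n] [DecidableEq n]

theorem msqrt_eq_sqrt {M : Matrix n n ℂ} (hM : 0 ≤ M) : msqrt M = CFC.sqrt M := by
  rw [CFC.sqrt_eq_real_sqrt M hM, cfcₙ_eq_cfc, msqrt]

theorem msqrt_nonneg (M : Matrix n n ℂ) : 0 ≤ msqrt M :=
  cfc_nonneg fun _ _ => Real.sqrt_nonneg _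

theorem conjTranspose_msqrt (M : Matrix n n ℂ) : (msqrt M)ᴴ = msqrt M :=
  (msqrt_nonneg M).posSemidef.isHermitian

theorem msqrt_mul_self {M : Matrix n n ℂ} (hM : 0 ≤ M) : msqrt M * msqrt M = M := by
  rw [msqrt_eq_sqrt hM, CFC.sqrt_mul_sqrt_self M hM]

theorem msqrt_eq {M S : Matrix n n ℂ} (hS : 0 ≤ S) (h : S * S = M) : msqrt M = S := by
  have hM : 0 ≤ M := h ▸ (IsSelfAdjoint.of_nonneg hS).mul_self_nonneg
  rw [msqrt_eq_sqrt hM, CFC.sqrt_unique h hS]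

theorem msqrt_mono {M N : Matrix n n ℂ} (hM : 0 ≤ M) (h : M ≤ N) : msqrt M ≤ msqrt N :=
  le_of_mul_self_le (conjTranspose_msqrt M) (msqrt_nonneg N)
    (by rwa [msqrt_mul_self hM, msqrt_mul_self (hM.trans h)])

theorem msqrt_smul {M : Matrix n n ℂ} (hM : 0 ≤ M) {c : ℝ} (hc : 0 ≤ c) :
    msqrt ((c : ℂ) • M) = (Real.sqrt c : ℂ) • msqrt M := by
  refine msqrt_eq (ofReal_smul_nonneg (msqrt_nonneg M) (Real.sqrt_nonneg c)) ?_
  rw [smul_mul_smul_comm, msqrt_mul_self hM, ← Complex.ofReal_mul, Real.mul_self_sqrt hc]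

theorem msqrt_kronecker {M : Matrix m m ℂ} {N : Matrix n n ℂ} (hM : 0 ≤ M) (hN : 0 ≤ N) :
    msqrt (M ⊗ₖ N) = msqrt M ⊗ₖ msqrt N := by
  refine msqrt_eq (kronecker_nonneg (msqrt_nonneg M) (msqrt_nonneg N)) ?_
  rw [← mul_kronecker_mul, msqrt_mul_self hM, msqrt_mul_self hN]

theorem msqrt_submatrix {M : Matrix n n ℂ} (hM : 0 ≤ M) (e : m ≃ n) :
    msqrt (M.submatrix e e) = (msqrt M).submatrix e e := by
  refine msqrt_eq ((msqrt_nonneg M).posSemidef.submatrix e).nonneg ?_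
  rw [submatrix_mul_equiv, msqrt_mul_self hM]

omit [Fintype m] [Fintype n] [DecidableEq n] in
theorem blockDiagonal_nonneg [Finite m] [Finite n] {M : m → Matrix n n ℂ} (hM : ∀ i, 0 ≤ M i) :
    0 ≤ blockDiagonal M := by
  classical
  have := Fintype.ofFinite m
  have := Fintype.ofFinite n
  have h : M = fun i => (msqrt (M i))ᴴ * msqrt (M i) :=
    funext fun i => by rw [conjTranspose_msqrt, msqrt_mul_self (hM i)]
  rw [h, blockDiagonal_mul, ← blockDiagonal_conjTranspose]
  exact conjTranspose_mul_self_nonneg _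

theorem msqrt_blockDiagonal {M : m → Matrix n n ℂ} (hM : ∀ i, 0 ≤ M i) :
    msqrt (blockDiagonal M) = blockDiagonal fun i => msqrt (M i) := by
  refine msqrt_eq (blockDiagonal_nonneg fun i => msqrt_nonneg (M i)) ?_
  simp only [← blockDiagonal_mul, msqrt_mul_self (hM _)]

theorem mabs_nonneg (M : Matrix n n ℂ) : 0 ≤ mabs M := msqrt_nonneg _

theorem mabs_mul_self (M : Matrix n n ℂ) : mabs M * mabs M = Mᴴ * M :=
  msqrt_mul_self (conjTranspose_mul_self_nonneg M)

theorem mabs_eq {M S : Matrix n n ℂ} (hS : 0 ≤ S) (h : S * S = Mᴴ * M) : mabs M = S :=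
  msqrt_eq hS h

theorem mabs_of_nonneg {M : Matrix n n ℂ} (hM : 0 ≤ M) : mabs M = M :=
  mabs_eq hM (by rw [hM.posSemidef.isHermitian.eq])

theorem mabs_neg (M : Matrix n n ℂ) : mabs (-M) = mabs M := by
  rw [mabs, conjTranspose_neg, neg_mul_neg, ← mabs]

theorem mabs_smul (M : Matrix n n ℂ) {c : ℝ} (hc : 0 ≤ c) :
    mabs ((c : ℂ) • M) = (c : ℂ) • mabs M := by
  refine mabs_eq (ofReal_smul_nonneg (mabs_nonneg M) hc) ?_
  rw [smul_mul_smul_comm, mabs_mul_self, conjTranspose_smul, smul_mul_smul_comm,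
    Complex.star_def, Complex.conj_ofReal]

theorem mabs_kronecker (M : Matrix m m ℂ) (N : Matrix n n ℂ) :
    mabs (M ⊗ₖ N) = mabs M ⊗ₖ mabs N := by
  refine mabs_eq (kronecker_nonneg (mabs_nonneg M) (mabs_nonneg N)) ?_
  rw [← mul_kronecker_mul, mabs_mul_self, mabs_mul_self, conjTranspose_kronecker,
    mul_kronecker_mul]

theorem mabs_submatrix (M : Matrix n n ℂ) (e : m ≃ n) :
    mabs (M.submatrix e e) = (mabs M).submatrix e e := by
  refine mabs_eq ((mabs_nonneg M).posSemidef.submatrix e).nonneg ?_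
  rw [submatrix_mul_equiv, mabs_mul_self, conjTranspose_submatrix, submatrix_mul_equiv]

theorem mabs_blockDiagonal (M : m → Matrix n n ℂ) :
    mabs (blockDiagonal M) = blockDiagonal fun i => mabs (M i) := by
  refine mabs_eq (blockDiagonal_nonneg fun i => mabs_nonneg (M i)) ?_
  rw [← blockDiagonal_mul, blockDiagonal_conjTranspose, ← blockDiagonal_mul]
  simp only [mabs_mul_self]

end Roots

section Contractions

variable {l m n : Type*} [Fintype m] [Fintype n]

theorem mul_eq_zero_of_conjTranspose_mul_self_le [Finite l] {A : Matrix m n ℂ}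
    {S : Matrix n n ℂ} (h : Aᴴ * A ≤ S * S) {B : Matrix n l ℂ} (hB : S * B = 0) :
    A * B = 0 := by
  have hle := conjTranspose_mul_mul_mono h B
  rw [Matrix.mul_assoc Bᴴ (S * S), Matrix.mul_assoc S, hB, Matrix.mul_zero, Matrix.mul_zero,
    ← Matrix.mul_assoc, Matrix.mul_assoc _ A, ← conjTranspose_mul] at hle
  exact conjTranspose_mul_self_eq_zero.1 (hle.antisymm (conjTranspose_mul_self_nonneg _))

variable [DecidableEq n]

/-- Matrices whose operator norm is at most one. -/
def IsContraction (K : Matrix m n ℂ) : Prop := Kᴴ * K ≤ 1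

theorem isContraction_one : IsContraction (1 : Matrix n n ℂ) := by
  rw [IsContraction, conjTranspose_one, Matrix.one_mul]

theorem IsContraction.conjTranspose [DecidableEq m] {K : Matrix m n ℂ} (hK : IsContraction K) :
    IsContraction Kᴴ := by
  -- Both inequalities say that the block matrix `[[1, K], [Kᴴ, 1]]` is positive semidefinite.
  let : Invertible (1 : Matrix m m ℂ) := invertibleOne
  let : Invertible (1 : Matrix n n ℂ) := invertibleOne
  have h₁ := PosDef.fromBlocks₁₁ (A := (1 : Matrix m m ℂ)) K (1 : Matrix n n ℂ) PosDef.one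
  have h₂ := PosDef.fromBlocks₂₂ (1 : Matrix m m ℂ) K (D := (1 : Matrix n n ℂ)) PosDef.one
  rw [inv_one, Matrix.mul_one, ← le_iff] at h₁ h₂
  rw [IsContraction, conjTranspose_conjTranspose]
  exact h₂.1 (h₁.2 hK)

theorem IsContraction.mul [Finite l] [DecidableEq l] {K : Matrix m n ℂ} {L : Matrix n l ℂ}
    (hK : IsContraction K) (hL : IsContraction L) : IsContraction (K * L) :=
  calc (K * L)ᴴ * (K * L) = Lᴴ * (Kᴴ * K) * L := by
        simp only [conjTranspose_mul, Matrix.mul_assoc]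
    _ ≤ Lᴴ * 1 * L := conjTranspose_mul_mul_mono hK L
    _ = Lᴴ * L := by rw [Matrix.mul_one]
    _ ≤ 1 := hL

/-- The Moore–Penrose inverse of a Hermitian matrix: since `0⁻¹ = 0`, the kernel is kept and the
nonzero eigenvalues are inverted. -/
def pseudoInverse (S : Matrix n n ℂ) : Matrix n n ℂ := cfc (fun x : ℝ => x⁻¹) S

theorem conjTranspose_pseudoInverse (S : Matrix n n ℂ) : (pseudoInverse S)ᴴ = pseudoInverse S :=
  cfc_predicate (fun x : ℝ => x⁻¹) S

theorem pseudoInverse_nonneg {S : Matrix n n ℂ} (hS : 0 ≤ S) : 0 ≤ pseudoInverse S :=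
  cfc_nonneg fun _ hx => inv_nonneg.2 (spectrum_nonneg_of_nonneg hS hx)

theorem cfc_mul_inv_eq_mul_pseudoInverse {S : Matrix n n ℂ} (hS : S.IsHermitian) :
    cfc (fun x : ℝ => x * x⁻¹) S = S * pseudoInverse S := by
  have hsa : IsSelfAdjoint S := hS
  rw [cfc_mul _ _ S (S.finite_real_spectrum.continuousOn _)
    (S.finite_real_spectrum.continuousOn _), cfc_id' ℝ S, pseudoInverse]

theorem mul_pseudoInverse_le_one {S : Matrix n n ℂ} (hS : S.IsHermitian) :
    S * pseudoInverse S ≤ 1 := by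
  rw [← cfc_mul_inv_eq_mul_pseudoInverse hS]
  exact cfc_le_one _ _ fun x _ => mul_inv_le_one

theorem mul_pseudoInverse_mul_self {S : Matrix n n ℂ} (hS : S.IsHermitian) :
    S * pseudoInverse S * S = S := by
  have hsa : IsSelfAdjoint S := hS
  have hc : ∀ f : ℝ → ℝ, ContinuousOn f (spectrum ℝ S) := S.finite_real_spectrum.continuousOn
  calc S * pseudoInverse S * S = cfc (fun x : ℝ => x * x⁻¹ * x) S := by
        rw [cfc_mul _ _ S (hc _) (hc _), cfc_mul_inv_eq_mul_pseudoInverse hS, cfc_id' ℝ S]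
    _ = cfc (fun x : ℝ => x) S := cfc_congr fun x _ => mul_inv_mul_cancel x
    _ = S := cfc_id' ℝ S

theorem pseudoInverse_mul_sq {S : Matrix n n ℂ} (hS : S.IsHermitian) :
    pseudoInverse S * (S * S) = S := by
  have hsa : IsSelfAdjoint S := hS
  have hcomm : Commute S (pseudoInverse S) := by
    have h := cfc_commute_cfc (fun x : ℝ => x) (fun x : ℝ => x⁻¹) S
    rwa [cfc_id' ℝ S] at h
  rw [← Matrix.mul_assoc, ← hcomm.eq, mul_pseudoInverse_mul_self hS]

theorem isContraction_mul_pseudoInverse {A : Matrix m n ℂ} {S : Matrix n n ℂ}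
    (hS : S.IsHermitian) (h : Aᴴ * A ≤ S * S) : IsContraction (A * pseudoInverse S) :=
  calc (A * pseudoInverse S)ᴴ * (A * pseudoInverse S)
      = (pseudoInverse S)ᴴ * (Aᴴ * A) * pseudoInverse S := by
        simp only [conjTranspose_mul, Matrix.mul_assoc]
    _ ≤ (pseudoInverse S)ᴴ * (S * S) * pseudoInverse S := conjTranspose_mul_mul_mono h _
    _ = S * pseudoInverse S := by rw [conjTranspose_pseudoInverse, pseudoInverse_mul_sq hS]
    _ ≤ 1 := mul_pseudoInverse_le_one hS

/-- Together with `isContraction_mul_pseudoInverse`, this is Douglas' factorization lemma. -/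
theorem mul_pseudoInverse_mul_of_le {A : Matrix m n ℂ} {S : Matrix n n ℂ} (hS : S.IsHermitian)
    (h : Aᴴ * A ≤ S * S) : A * pseudoInverse S * S = A := by
  have hker : S * (1 - pseudoInverse S * S) = 0 := by
    rw [Matrix.mul_sub, Matrix.mul_one, ← Matrix.mul_assoc, mul_pseudoInverse_mul_self hS,
      sub_self]
  have hA := mul_eq_zero_of_conjTranspose_mul_self_le h hker
  rw [Matrix.mul_sub, Matrix.mul_one, sub_eq_zero] at hA
  rw [Matrix.mul_assoc, ← hA]

end Contractions

section TraceNorm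

variable {n : Type} [Fintype n] [DecidableEq n]

theorem re_trace_mul_le_of_isContraction {K H : Matrix n n ℂ} (hK : IsContraction K)
    (hH : 0 ≤ H) : (K * H).trace.re ≤ H.trace.re := by
  set R := msqrt H
  have hR : Rᴴ = R := conjTranspose_msqrt H
  have hRR : R * R = H := msqrt_mul_self hH
  have htr : (R * (K * R)).trace = (K * H).trace := by
    rw [trace_mul_comm, Matrix.mul_assoc, hRR]
  have hexpand : (R - K * R)ᴴ * (R - K * R)
      = H - R * (K * R) - (R * (K * R))ᴴ + R * (Kᴴ * K) * R := by
    simp only [conjTranspose_sub, conjTranspose_mul, hR, Matrix.mul_sub, Matrix.sub_mul,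
      Matrix.mul_assoc, hRR]
    abel
  have hle : (R * (Kᴴ * K) * R).trace.re ≤ H.trace.re := by
    have h := re_trace_mono (conjTranspose_mul_mul_mono hK R)
    rwa [Matrix.mul_one, hR, hRR] at h
  have hsq := re_trace_nonneg (conjTranspose_mul_self_nonneg (R - K * R))
  rw [hexpand, trace_add, trace_sub, trace_sub, Complex.add_re, Complex.sub_re, Complex.sub_re,
    re_trace_conjTranspose, htr] at hsq
  linarith

theorem re_trace_mul_le_re_trace_mabs {K : Matrix n n ℂ} (hK : IsContraction K)
    (M : Matrix n n ℂ) : (K * M).trace.re ≤ (mabs M).trace.re := by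
  have hS : (mabs M).IsHermitian := (mabs_nonneg M).posSemidef.isHermitian
  have hM : Mᴴ * M ≤ mabs M * mabs M := (mabs_mul_self M).ge
  have h := re_trace_mul_le_of_isContraction
    (hK.mul (isContraction_mul_pseudoInverse hS hM)) (mabs_nonneg M)
  rwa [Matrix.mul_assoc, mul_pseudoInverse_mul_of_le hS hM] at h

theorem exists_isContraction_mul_eq_mabs (M : Matrix n n ℂ) :
    ∃ K : Matrix n n ℂ, IsContraction K ∧ K * M = mabs M := by
  have hS : (mabs M).IsHermitian := (mabs_nonneg M).posSemidef.isHermitian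
  refine ⟨(M * pseudoInverse (mabs M))ᴴ,
    (isContraction_mul_pseudoInverse hS (mabs_mul_self M).ge).conjTranspose, ?_⟩
  rw [conjTranspose_mul, conjTranspose_pseudoInverse, Matrix.mul_assoc, ← mabs_mul_self,
    pseudoInverse_mul_sq hS]

end TraceNorm

section GeometricMean

variable {m n : Type*} [Fintype m] [Fintype n] {A B : Matrix m n ℂ} {S T : Matrix n n ℂ}

theorem sandwich_pseudoInverse_sq_le [DecidableEq n] (hS : S.IsHermitian) (hST : Commute S T)
    (hA : Aᴴ * A ≤ S * S) (hB : Bᴴ * B ≤ T * T) (hAB : (Aᴴ * B).IsHermitian) :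
    (pseudoInverse S * (Aᴴ * B) * pseudoInverse S) * (pseudoInverse S * (Aᴴ * B) * pseudoInverse S)
      ≤ (pseudoInverse S * T) * (pseudoInverse S * T) := by
  classical
  set G := pseudoInverse S
  have hG : Gᴴ = G := conjTranspose_pseudoInverse S
  have hGT : G * T = T * G := (hST.cfc_real _).eq
  have hK : (A * G)ᴴᴴ * (A * G)ᴴ ≤ 1 := (isContraction_mul_pseudoInverse hS hA).conjTranspose
  calc (G * (Aᴴ * B) * G) * (G * (Aᴴ * B) * G)
      = (B * G)ᴴ * ((A * G)ᴴᴴ * (A * G)ᴴ) * (B * G) := by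
        nth_rw 1 [← hAB.eq]
        simp only [conjTranspose_mul, conjTranspose_conjTranspose, hG, Matrix.mul_assoc]
    _ ≤ (B * G)ᴴ * 1 * (B * G) := conjTranspose_mul_mul_mono hK _
    _ = Gᴴ * (Bᴴ * B) * G := by simp only [conjTranspose_mul, Matrix.mul_one, Matrix.mul_assoc]
    _ ≤ Gᴴ * (T * T) * G := conjTranspose_mul_mul_mono hB G
    _ = G * T * (T * G) := by simp only [hG, Matrix.mul_assoc]
    _ = (G * T) * (G * T) := by rw [hGT]

/-- The geometric mean `S * T` of the commuting squares `S²` and `T²` dominates the Hermitian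
`X` for which the block matrix `[[S², X], [X, T²]]` is positive semidefinite. -/
theorem conjTranspose_mul_le_mul (hS : 0 ≤ S) (hT : 0 ≤ T) (hST : Commute S T)
    (hA : Aᴴ * A ≤ S * S) (hB : Bᴴ * B ≤ T * T) (hAB : (Aᴴ * B).IsHermitian) :
    Aᴴ * B ≤ S * T := by
  classical
  set G := pseudoInverse S
  have hSH : Sᴴ = S := hS.posSemidef.isHermitian
  have hG : Gᴴ = G := conjTranspose_pseudoInverse S
  have hle : G * (Aᴴ * B) * G ≤ G * T := by
    have hGT : 0 ≤ G * T := (hST.cfc_real _).mul_nonneg (pseudoInverse_nonneg hS) hT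
    refine le_of_mul_self_le ?_ hGT (sandwich_pseudoInverse_sq_le hSH hST hA hB hAB)
    rw [IsHermitian, conjTranspose_mul _ G, conjTranspose_mul G, hG, hAB.eq, Matrix.mul_assoc G]
  have hleft : S * G * (Aᴴ * B) = Aᴴ * B := by
    nth_rw 2 [← mul_pseudoInverse_mul_of_le hSH hA]
    simp only [conjTranspose_mul, hSH, conjTranspose_pseudoInverse, Matrix.mul_assoc, G]
  have hright : Aᴴ * B * (G * S) = Aᴴ * B := by
    have h := congrArg conjTranspose hleft
    rwa [conjTranspose_mul (S * G), conjTranspose_mul S, hAB.eq, hG, hSH] at h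
  calc Aᴴ * B = S * G * (Aᴴ * B) * (G * S) := by rw [hleft, hright]
    _ = Sᴴ * (G * (Aᴴ * B) * G) * S := by rw [hSH]; simp only [Matrix.mul_assoc]
    _ ≤ Sᴴ * (G * T) * S := conjTranspose_mul_mul_mono hle S
    _ = S * G * S * T := by simp only [hSH, Matrix.mul_assoc, hST.eq]
    _ = S * T := by rw [mul_pseudoInverse_mul_self hSH]

end GeometricMean

section PartialTrace

variable {n x r : Type*} [Fintype x]

/-- The partial trace over the second factor. -/
def partialTrace (M : Matrix (n × x) (n × x) ℂ) : Matrix n n ℂ :=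
  ∑ k, M.submatrix (·, k) (·, k)

theorem partialTrace_apply (M : Matrix (n × x) (n × x) ℂ) (i j : n) :
    partialTrace M i j = ∑ k, M (i, k) (j, k) := by
  rw [partialTrace, Matrix.sum_apply]
  rfl

theorem partialTrace_mono {M N : Matrix (n × x) (n × x) ℂ} (h : M ≤ N) :
    partialTrace M ≤ partialTrace N :=
  Finset.sum_le_sum fun _ _ => le_iff.2 ((le_iff.1 h).submatrix _)

theorem partialTrace_nonneg {M : Matrix (n × x) (n × x) ℂ} (hM : 0 ≤ M) : 0 ≤ partialTrace M :=
  Finset.sum_nonneg fun _ _ => (hM.posSemidef.submatrix _).nonneg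

theorem partialTrace_blockDiagonal [DecidableEq x] (M : x → Matrix n n ℂ) :
    partialTrace (blockDiagonal M) = ∑ i, M i := by
  ext i j
  simp only [partialTrace_apply, blockDiagonal_apply_eq, Matrix.sum_apply]

/-- The matrix `A` with the second factor of its column space moved to the rows. -/
def foldRows (A : Matrix r (n × x) ℂ) : Matrix (r × x) n ℂ :=
  Matrix.of fun p j => A p.1 (j, p.2)

theorem conjTranspose_foldRows_mul_foldRows [Fintype r] (A B : Matrix r (n × x) ℂ) :
    (foldRows A)ᴴ * foldRows B = partialTrace (Aᴴ * B) := by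
  ext i j
  simp only [foldRows, partialTrace_apply, mul_apply, conjTranspose_apply, of_apply,
    Fintype.sum_prod_type_right]

variable [Fintype n]

theorem trace_partialTrace (M : Matrix (n × x) (n × x) ℂ) : (partialTrace M).trace = M.trace := by
  simp only [trace, diag_apply, partialTrace_apply, Fintype.sum_prod_type]

theorem trace_mul_kronecker_one [DecidableEq x] (M : Matrix (n × x) (n × x) ℂ)
    (X : Matrix n n ℂ) : (M * (X ⊗ₖ (1 : Matrix x x ℂ))).trace = (partialTrace M * X).trace := by
  simp only [trace, diag_apply, mul_apply, kronecker_apply, one_apply, partialTrace_apply,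
    Fintype.sum_prod_type, mul_ite, mul_one, mul_zero, Finset.sum_ite_eq', Finset.mem_univ,
    if_true, Finset.sum_mul]
  exact Finset.sum_congr rfl fun _ _ => Finset.sum_comm

theorem trace_kronecker_one_mul_mul_kronecker_one [DecidableEq x] (M : Matrix (n × x) (n × x) ℂ)
    (X Y : Matrix n n ℂ) :
    (X ⊗ₖ (1 : Matrix x x ℂ) * M * Y ⊗ₖ (1 : Matrix x x ℂ)).trace
      = (X * partialTrace M * Y).trace := by
  rw [Matrix.mul_assoc, trace_mul_comm, Matrix.mul_assoc, ← mul_kronecker_mul, Matrix.one_mul,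
    trace_mul_kronecker_one, ← Matrix.mul_assoc, trace_mul_comm, Matrix.mul_assoc]

end PartialTrace

theorem IsState.partialTrace {n x : Type} [Fintype n] [Fintype x]
    {M : Matrix (n × x) (n × x) ℂ} (hM : IsState M) : IsState (partialTrace M) :=
  ⟨(partialTrace_nonneg hM.1.nonneg).posSemidef, by rw [trace_partialTrace, hM.2]⟩

section Vectorisation

variable {l m n x : Type*} [Fintype l] [Fintype m] [Fintype n]

theorem ext_of_star_vec_dotProduct_mulVec {P Q : Matrix (n × m) (n × m) ℂ}
    (h : ∀ X Y, star (vec X) ⬝ᵥ (P *ᵥ vec Y) = star (vec X) ⬝ᵥ (Q *ᵥ vec Y)) : P = Q := by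
  classical
  ext i j
  obtain ⟨X, hX⟩ := vec_bijective.surjective (Pi.single i 1 : n × m → ℂ)
  obtain ⟨Y, hY⟩ := vec_bijective.surjective (Pi.single j 1 : n × m → ℂ)
  have hXY := h X Y
  rwa [hX, hY, ← Pi.single_star, star_one, single_one_dotProduct, single_one_dotProduct,
    mulVec_single_one, mulVec_single_one] at hXY

theorem star_vec_dotProduct_conjTranspose_mul_mulVec_vec (A B : Matrix l (n × m) ℂ)
    (X Y : Matrix m n ℂ) :
    star (vec X) ⬝ᵥ ((Aᴴ * B) *ᵥ vec Y) = star (A *ᵥ vec X) ⬝ᵥ (B *ᵥ vec Y) := by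
  rw [star_mulVec, ← dotProduct_mulVec, mulVec_mulVec]

/-- The matrix of `X ↦ X ⊗ 1` with respect to `Matrix.vec`. -/
def ampliation (n x : Type*) [DecidableEq n] [DecidableEq x] :
    Matrix ((n × x) × (n × x)) (n × n) ℂ :=
  Matrix.of fun p q => if q = (p.1.1, p.2.1) ∧ p.1.2 = p.2.2 then 1 else 0

variable [DecidableEq n] [DecidableEq x]

theorem ampliation_mulVec_vec (X : Matrix n n ℂ) :
    ampliation n x *ᵥ vec X = vec (X ⊗ₖ (1 : Matrix x x ℂ)) := by
  ext p
  simp [ampliation, mulVec, dotProduct, vec, one_apply, ite_and, eq_comm]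

variable [Fintype x]

/-- The matrix of `X ↦ M (X ⊗ 1)` with respect to `Matrix.vec`. -/
def leftAmpliation (M : Matrix (n × x) (n × x) ℂ) : Matrix ((n × x) × (n × x)) (n × n) ℂ :=
  ((1 : Matrix (n × x) (n × x) ℂ) ⊗ₖ M) * ampliation n x

/-- The matrix of `X ↦ (X ⊗ 1) M` with respect to `Matrix.vec`. -/
def rightAmpliation (M : Matrix (n × x) (n × x) ℂ) : Matrix ((n × x) × (n × x)) (n × n) ℂ :=
  (Mᵀ ⊗ₖ (1 : Matrix (n × x) (n × x) ℂ)) * ampliation n x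

theorem leftAmpliation_mulVec_vec (M : Matrix (n × x) (n × x) ℂ) (X : Matrix n n ℂ) :
    leftAmpliation M *ᵥ vec X = vec (M * X ⊗ₖ (1 : Matrix x x ℂ)) := by
  rw [leftAmpliation, ← mulVec_mulVec, ampliation_mulVec_vec, kronecker_mulVec_vec, transpose_one,
    Matrix.mul_one]

theorem rightAmpliation_mulVec_vec (M : Matrix (n × x) (n × x) ℂ) (X : Matrix n n ℂ) :
    rightAmpliation M *ᵥ vec X = vec (X ⊗ₖ (1 : Matrix x x ℂ) * M) := by
  rw [rightAmpliation, ← mulVec_mulVec, ampliation_mulVec_vec, kronecker_mulVec_vec,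
    transpose_transpose, Matrix.one_mul]

theorem conjTranspose_leftAmpliation_mul_self (M : Matrix (n × x) (n × x) ℂ) :
    (leftAmpliation M)ᴴ * leftAmpliation M = (1 : Matrix n n ℂ) ⊗ₖ partialTrace (Mᴴ * M) := by
  refine ext_of_star_vec_dotProduct_mulVec fun X Y => ?_
  rw [star_vec_dotProduct_conjTranspose_mul_mulVec_vec, leftAmpliation_mulVec_vec,
    leftAmpliation_mulVec_vec, kronecker_mulVec_vec, star_vec_dotProduct_vec,
    star_vec_dotProduct_vec, transpose_one, Matrix.mul_one, ← Matrix.mul_assoc Xᴴ,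
    ← trace_kronecker_one_mul_mul_kronecker_one]
  simp only [conjTranspose_mul, conjTranspose_kronecker, conjTranspose_one, Matrix.mul_assoc]

theorem conjTranspose_rightAmpliation_mul_self (M : Matrix (n × x) (n × x) ℂ) :
    (rightAmpliation M)ᴴ * rightAmpliation M = (partialTrace (M * Mᴴ))ᵀ ⊗ₖ (1 : Matrix n n ℂ) := by
  refine ext_of_star_vec_dotProduct_mulVec fun X Y => ?_
  rw [star_vec_dotProduct_conjTranspose_mul_mulVec_vec, rightAmpliation_mulVec_vec,
    rightAmpliation_mulVec_vec, kronecker_mulVec_vec, star_vec_dotProduct_vec,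
    star_vec_dotProduct_vec, transpose_transpose, Matrix.one_mul, trace_mul_comm,
    trace_mul_comm Xᴴ, ← trace_kronecker_one_mul_mul_kronecker_one]
  simp only [conjTranspose_mul, conjTranspose_kronecker, conjTranspose_one, Matrix.mul_assoc]

theorem star_vec_dotProduct_leftAmpliation_rightAmpliation (M N : Matrix (n × x) (n × x) ℂ)
    (X Y : Matrix n n ℂ) :
    star (vec X) ⬝ᵥ (((leftAmpliation M)ᴴ * rightAmpliation N) *ᵥ vec Y)
      = ((X ⊗ₖ (1 : Matrix x x ℂ))ᴴ * Mᴴ * (Y ⊗ₖ (1 : Matrix x x ℂ)) * N).trace := by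
  rw [star_vec_dotProduct_conjTranspose_mul_mulVec_vec, leftAmpliation_mulVec_vec,
    rightAmpliation_mulVec_vec, star_vec_dotProduct_vec, conjTranspose_mul, ← Matrix.mul_assoc]

theorem isHermitian_conjTranspose_leftAmpliation_mul_rightAmpliation
    {M N : Matrix (n × x) (n × x) ℂ} (hM : M.IsHermitian) (hN : N.IsHermitian) :
    ((leftAmpliation M)ᴴ * rightAmpliation N).IsHermitian := by
  refine ext_of_star_vec_dotProduct_mulVec fun X Y => ?_
  rw [star_vec_dotProduct_leftAmpliation_rightAmpliation, conjTranspose_mul,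
    conjTranspose_conjTranspose, star_vec_dotProduct_conjTranspose_mul_mulVec_vec,
    rightAmpliation_mulVec_vec, leftAmpliation_mulVec_vec, star_vec_dotProduct_vec,
    conjTranspose_mul, hM.eq, hN.eq, Matrix.mul_assoc, trace_mul_comm N]
  simp only [Matrix.mul_assoc]

end Vectorisation

section Affinity

variable {n x : Type} [Fintype n] [DecidableEq n] [Fintype x] [DecidableEq x]

/-- The quantum affinity `Tr √ρ √σ`. -/
def affinity (n : Type) [Fintype n] [DecidableEq n] (ρ σ : Matrix n n ℂ) : ℝ :=
  (msqrt ρ * msqrt σ).trace.re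

theorem re_trace_msqrt_sub_sq {ρ σ : Matrix n n ℂ} (hρ : IsState ρ) (hσ : IsState σ) :
    ((msqrt σ - msqrt ρ)ᴴ * (msqrt σ - msqrt ρ)).trace.re = 2 - 2 * affinity n ρ σ := by
  rw [conjTranspose_sub, conjTranspose_msqrt, conjTranspose_msqrt, Matrix.mul_sub, Matrix.sub_mul,
    Matrix.sub_mul, msqrt_mul_self hρ.1.nonneg, msqrt_mul_self hσ.1.nonneg, trace_sub, trace_sub,
    trace_sub, hρ.2, hσ.2, trace_mul_comm (msqrt σ) (msqrt ρ), affinity]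
  simp only [Complex.sub_re, Complex.one_re]
  ring

theorem affinity_le_one {ρ σ : Matrix n n ℂ} (hρ : IsState ρ) (hσ : IsState σ) :
    affinity n ρ σ ≤ 1 := by
  have h := re_trace_nonneg (conjTranspose_mul_self_nonneg (msqrt σ - msqrt ρ))
  rw [re_trace_msqrt_sub_sq hρ hσ] at h
  linarith

theorem affinity_eq_one_iff {ρ σ : Matrix n n ℂ} (hρ : IsState ρ) (hσ : IsState σ) :
    affinity n ρ σ = 1 ↔ σ = ρ := by
  constructor
  · intro h
    have hzero : (msqrt σ - msqrt ρ)ᴴ * (msqrt σ - msqrt ρ) = 0 :=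
      eq_zero_of_re_trace_eq_zero (conjTranspose_mul_self_nonneg _)
        (by rw [re_trace_msqrt_sub_sq hρ hσ, h, mul_one, sub_self])
    have hsqrt : msqrt σ = msqrt ρ := sub_eq_zero.1 (conjTranspose_mul_self_eq_zero.1 hzero)
    rw [← msqrt_mul_self hρ.1.nonneg, ← msqrt_mul_self hσ.1.nonneg, hsqrt]
  · rintro rfl
    rw [affinity, msqrt_mul_self hρ.1.nonneg, hρ.2, Complex.one_re]

/-- The right-hand side is the geometric mean of the forms `Tr Xᴴ (Tr_x ρ) X` and
`Tr X (Tr_x σ) Xᴴ`, which are the restrictions of the corresponding forms of `ρ` and `σ`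
to the matrices `X ⊗ 1`. -/
theorem re_trace_kronecker_one_mul_msqrt_le {ρ σ : Matrix (n × x) (n × x) ℂ} (hρ : 0 ≤ ρ)
    (hσ : 0 ≤ σ) (X : Matrix n n ℂ) :
    ((X ⊗ₖ (1 : Matrix x x ℂ))ᴴ * msqrt ρ * (X ⊗ₖ (1 : Matrix x x ℂ)) * msqrt σ).trace.re
      ≤ (Xᴴ * msqrt (partialTrace ρ) * X * msqrt (partialTrace σ)).trace.re := by
  set R := msqrt (partialTrace ρ)
  set S := msqrt (partialTrace σ)
  have hle : (leftAmpliation (msqrt ρ))ᴴ * rightAmpliation (msqrt σ)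
      ≤ ((1 : Matrix n n ℂ) ⊗ₖ R) * (Sᵀ ⊗ₖ (1 : Matrix n n ℂ)) := by
    refine conjTranspose_mul_le_mul (kronecker_nonneg zero_le_one (msqrt_nonneg _))
      (kronecker_nonneg (msqrt_nonneg _).posSemidef.transpose.nonneg zero_le_one) ?_ ?_ ?_
      (isHermitian_conjTranspose_leftAmpliation_mul_rightAmpliation (conjTranspose_msqrt ρ)
        (conjTranspose_msqrt σ))
    · simp only [Commute, SemiconjBy, ← mul_kronecker_mul, Matrix.one_mul, Matrix.mul_one]
    · rw [conjTranspose_leftAmpliation_mul_self, conjTranspose_msqrt, msqrt_mul_self hρ,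
        ← mul_kronecker_mul, msqrt_mul_self (partialTrace_nonneg hρ), Matrix.one_mul]
    · rw [conjTranspose_rightAmpliation_mul_self, conjTranspose_msqrt, msqrt_mul_self hσ,
        ← mul_kronecker_mul, ← transpose_mul, msqrt_mul_self (partialTrace_nonneg hσ),
        Matrix.one_mul]
  have hX := (Complex.le_def.1 ((le_iff.1 hle).dotProduct_mulVec_nonneg (vec X))).1
  rwa [sub_mulVec, dotProduct_sub, star_vec_dotProduct_leftAmpliation_rightAmpliation,
    conjTranspose_msqrt, ← mul_kronecker_mul, Matrix.one_mul, Matrix.mul_one,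
    kronecker_mulVec_vec, star_vec_dotProduct_vec, transpose_transpose, Complex.sub_re,
    Complex.zero_re, sub_nonneg, ← Matrix.mul_assoc, ← Matrix.mul_assoc] at hX

theorem affinity_le_affinity_partialTrace {ρ σ : Matrix (n × x) (n × x) ℂ} (hρ : 0 ≤ ρ)
    (hσ : 0 ≤ σ) : affinity (n × x) ρ σ ≤ affinity n (partialTrace ρ) (partialTrace σ) := by
  have h := re_trace_kronecker_one_mul_msqrt_le hρ hσ 1
  rwa [one_kronecker_one, conjTranspose_one, conjTranspose_one, Matrix.one_mul, Matrix.one_mul,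
    Matrix.mul_one, Matrix.mul_one] at h

theorem inv_sqrt_le_affinity {ρ σ : Matrix n n ℂ} (hρ : IsState ρ) (hσ : 0 ≤ σ) {d : ℝ}
    (hd : 0 < d) (h : ρ ≤ (d : ℂ) • σ) : 1 / Real.sqrt d ≤ affinity n ρ σ := by
  set R := msqrt (msqrt ρ)
  have hR : Rᴴ = R := conjTranspose_msqrt _
  have hRR : R * R = msqrt ρ := msqrt_mul_self (msqrt_nonneg ρ)
  have hle : msqrt ρ ≤ (Real.sqrt d : ℂ) • msqrt σ := by
    rw [← msqrt_smul hσ hd.le]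
    exact msqrt_mono hρ.1.nonneg h
  have htr := re_trace_mono (conjTranspose_mul_mul_mono hle R)
  rw [Matrix.mul_assoc, Matrix.mul_assoc, trace_mul_comm, hR, Matrix.mul_assoc, hRR,
    msqrt_mul_self hρ.1.nonneg, hρ.2, trace_mul_comm, Matrix.mul_assoc, hRR, smul_mul_assoc,
    re_trace_ofReal_smul, trace_mul_comm, Complex.one_re] at htr
  rwa [affinity, div_le_iff₀' (Real.sqrt_pos.2 hd)]

end Affinity

section RootFidelity

variable {n x : Type} [Fintype n] [DecidableEq n] [Fintype x] [DecidableEq x]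

/-- The square root `‖√σ √ρ‖₁` of the fidelity. -/
def rootFidelity (n : Type) [Fintype n] [DecidableEq n] (ρ σ : Matrix n n ℂ) : ℝ :=
  (mabs (msqrt σ * msqrt ρ)).trace.re

theorem rootFidelity_nonneg (ρ σ : Matrix n n ℂ) : 0 ≤ rootFidelity n ρ σ :=
  re_trace_nonneg (mabs_nonneg _)

theorem affinity_le_rootFidelity (ρ σ : Matrix n n ℂ) : affinity n ρ σ ≤ rootFidelity n ρ σ := by
  have h := re_trace_mul_le_re_trace_mabs isContraction_one (msqrt σ * msqrt ρ)
  rwa [Matrix.one_mul, trace_mul_comm] at h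

/-- One half of Uhlmann's theorem. -/
theorem re_trace_conjTranspose_mul_le_rootFidelity {r : Type*} [Fintype r] {A B : Matrix r n ℂ}
    {ρ σ : Matrix n n ℂ} (hA : Aᴴ * A ≤ ρ) (hB : Bᴴ * B ≤ σ) :
    (Aᴴ * B).trace.re ≤ rootFidelity n ρ σ := by
  classical
  have hR := conjTranspose_msqrt ρ
  have hS := conjTranspose_msqrt σ
  rw [← msqrt_mul_self ((conjTranspose_mul_self_nonneg A).trans hA)] at hA
  rw [← msqrt_mul_self ((conjTranspose_mul_self_nonneg B).trans hB)] at hB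
  set V := A * pseudoInverse (msqrt ρ)
  set W := B * pseudoInverse (msqrt σ)
  have hVW : IsContraction (Vᴴ * W) :=
    (isContraction_mul_pseudoInverse hR hA).conjTranspose.mul
      (isContraction_mul_pseudoInverse hS hB)
  calc (Aᴴ * B).trace.re
      = ((V * msqrt ρ)ᴴ * (W * msqrt σ)).trace.re := by
        rw [mul_pseudoInverse_mul_of_le hR hA, mul_pseudoInverse_mul_of_le hS hB]
    _ = (Vᴴ * W * (msqrt σ * msqrt ρ)).trace.re := by
        rw [conjTranspose_mul, hR, Matrix.mul_assoc, trace_mul_comm]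
        simp only [Matrix.mul_assoc]
    _ ≤ rootFidelity n ρ σ := re_trace_mul_le_re_trace_mabs hVW _

/-- The other half of Uhlmann's theorem. -/
theorem exists_re_trace_mul_eq_rootFidelity (ρ : Matrix n n ℂ) {σ : Matrix n n ℂ} (hσ : 0 ≤ σ) :
    ∃ B : Matrix n n ℂ, Bᴴ * B ≤ σ ∧ (msqrt ρ * B).trace.re = rootFidelity n ρ σ := by
  obtain ⟨K, hK, hmabs⟩ := exists_isContraction_mul_eq_mabs (msqrt σ * msqrt ρ)
  refine ⟨K * msqrt σ, ?_, ?_⟩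
  · calc (K * msqrt σ)ᴴ * (K * msqrt σ) = (msqrt σ)ᴴ * (Kᴴ * K) * msqrt σ := by
          simp only [conjTranspose_mul, Matrix.mul_assoc]
      _ ≤ (msqrt σ)ᴴ * 1 * msqrt σ := conjTranspose_mul_mul_mono hK _
      _ = σ := by rw [Matrix.mul_one, conjTranspose_msqrt, msqrt_mul_self hσ]
  · rw [rootFidelity, ← hmabs, trace_mul_comm, Matrix.mul_assoc]

theorem exists_re_trace_msqrt_sub_sq_le {ρ σ : Matrix n n ℂ} (hρ : IsState ρ) (hσ : IsState σ) :
    ∃ B : Matrix n n ℂ, Bᴴ * B ≤ σ ∧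
      ((msqrt ρ - B)ᴴ * (msqrt ρ - B)).trace.re ≤ 2 - 2 * rootFidelity n ρ σ := by
  obtain ⟨B, hB, h⟩ := exists_re_trace_mul_eq_rootFidelity ρ hσ.1.nonneg
  refine ⟨B, hB, ?_⟩
  have hBB : (Bᴴ * B).trace.re ≤ 1 := by simpa only [hσ.2, Complex.one_re] using re_trace_mono hB
  have hflip : (Bᴴ * msqrt ρ).trace.re = (msqrt ρ * B).trace.re := by
    rw [← re_trace_conjTranspose, conjTranspose_mul, conjTranspose_conjTranspose,
      conjTranspose_msqrt]
  rw [conjTranspose_sub, conjTranspose_msqrt, Matrix.mul_sub, Matrix.sub_mul, Matrix.sub_mul,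
    msqrt_mul_self hρ.1.nonneg, trace_sub, trace_sub, trace_sub, hρ.2]
  simp only [Complex.sub_re, Complex.one_re, hflip, h]
  linarith

theorem rootFidelity_le_one {ρ σ : Matrix n n ℂ} (hρ : IsState ρ) (hσ : IsState σ) :
    rootFidelity n ρ σ ≤ 1 := by
  obtain ⟨B, -, h⟩ := exists_re_trace_msqrt_sub_sq_le hρ hσ
  linarith [re_trace_nonneg (conjTranspose_mul_self_nonneg (msqrt ρ - B))]

theorem rootFidelity_eq_one_iff {ρ σ : Matrix n n ℂ} (hρ : IsState ρ) (hσ : IsState σ) :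
    rootFidelity n ρ σ = 1 ↔ σ = ρ := by
  constructor
  · intro hone
    obtain ⟨B, hB, h⟩ := exists_re_trace_msqrt_sub_sq_le hρ hσ
    have hnonneg := conjTranspose_mul_self_nonneg (msqrt ρ - B)
    have hzero := eq_zero_of_re_trace_eq_zero hnonneg
      (le_antisymm (by rwa [hone, mul_one, sub_self] at h) (re_trace_nonneg hnonneg))
    rw [← sub_eq_zero.1 (conjTranspose_mul_self_eq_zero.1 hzero), conjTranspose_msqrt,
      msqrt_mul_self hρ.1.nonneg] at hB
    refine sub_eq_zero.1 (eq_zero_of_re_trace_eq_zero (sub_nonneg.2 hB) ?_)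
    rw [trace_sub, hσ.2, hρ.2, sub_self, Complex.zero_re]
  · intro h
    refine le_antisymm (rootFidelity_le_one hρ hσ) ?_
    rw [← (affinity_eq_one_iff hρ hσ).2 h]
    exact affinity_le_rootFidelity ρ σ

theorem rootFidelity_le_rootFidelity_partialTrace {ρ σ : Matrix (n × x) (n × x) ℂ} (hρ : 0 ≤ ρ)
    (hσ : 0 ≤ σ) :
    rootFidelity (n × x) ρ σ ≤ rootFidelity n (partialTrace ρ) (partialTrace σ) := by
  obtain ⟨B, hB, h⟩ := exists_re_trace_mul_eq_rootFidelity ρ hσ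
  have hle := re_trace_conjTranspose_mul_le_rootFidelity (A := foldRows (msqrt ρ))
    (B := foldRows B) (ρ := partialTrace ρ) (σ := partialTrace σ)
    (by rw [conjTranspose_foldRows_mul_foldRows, conjTranspose_msqrt, msqrt_mul_self hρ])
    (by rw [conjTranspose_foldRows_mul_foldRows]; exact partialTrace_mono hB)
  rwa [conjTranspose_foldRows_mul_foldRows, trace_partialTrace, conjTranspose_msqrt, h] at hle

end RootFidelity

section Similarity

/-- A family of functions of two density operators which behaves like the affinity and the
square root of the fidelity. -/
structure IsSimilarity
    (f : ∀ (n : Type) [Fintype n] [DecidableEq n], Matrix n n ℂ → Matrix n n ℂ → ℝ) : Prop where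
  le_one : ∀ {n : Type} [Fintype n] [DecidableEq n] {ρ σ : Matrix n n ℂ},
    IsState ρ → IsState σ → f n ρ σ ≤ 1
  eq_one_iff : ∀ {n : Type} [Fintype n] [DecidableEq n] {ρ σ : Matrix n n ℂ},
    IsState ρ → IsState σ → (f n ρ σ = 1 ↔ σ = ρ)
  le_partialTrace : ∀ {n x : Type} [Fintype n] [DecidableEq n] [Fintype x] [DecidableEq x]
    {ρ σ : Matrix (n × x) (n × x) ℂ}, 0 ≤ ρ → 0 ≤ σ →
    f (n × x) ρ σ ≤ f n (partialTrace ρ) (partialTrace σ)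
  blockDiagonal : ∀ {n x : Type} [Fintype n] [DecidableEq n] [Fintype x] [DecidableEq x]
    {ρ σ : x → Matrix n n ℂ}, (∀ i, 0 ≤ ρ i) → (∀ i, 0 ≤ σ i) →
    f (n × x) (Matrix.blockDiagonal ρ) (Matrix.blockDiagonal σ) = ∑ i, f n (ρ i) (σ i)
  smul : ∀ {n : Type} [Fintype n] [DecidableEq n] {ρ σ : Matrix n n ℂ} {c : ℝ},
    0 ≤ ρ → 0 ≤ σ → 0 ≤ c → f n ((c : ℂ) • ρ) ((c : ℂ) • σ) = c * f n ρ σ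
  kronecker : ∀ {n x : Type} [Fintype n] [DecidableEq n] [Fintype x] [DecidableEq x]
    {ρ σ : Matrix n n ℂ} {τ : Matrix x x ℂ}, 0 ≤ ρ → 0 ≤ σ → IsState τ →
    f (n × x) (ρ ⊗ₖ τ) (σ ⊗ₖ τ) = f n ρ σ
  submatrix : ∀ {n m : Type} [Fintype n] [DecidableEq n] [Fintype m] [DecidableEq m]
    {ρ σ : Matrix n n ℂ} (e : m ≃ n), 0 ≤ ρ → 0 ≤ σ →
    f m (ρ.submatrix e e) (σ.submatrix e e) = f n ρ σ
  inv_sqrt_le : ∀ {n : Type} [Fintype n] [DecidableEq n] {ρ σ : Matrix n n ℂ} {d : ℝ},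
    IsState ρ → 0 ≤ σ → 0 < d → ρ ≤ (d : ℂ) • σ → 1 / Real.sqrt d ≤ f n ρ σ
  eq_inv_sqrt : ∀ {n : Type} [Fintype n] [DecidableEq n] {ρ σ : Matrix n n ℂ} {d : ℝ},
    IsState ρ → 0 ≤ σ → 0 ≤ d → ρ * ρ = ρ → (d : ℂ) • (σ * σ) = σ →
    (d : ℂ) • (σ * ρ) = ρ → f n ρ σ = 1 / Real.sqrt d

theorem msqrt_mul_msqrt_eq_smul {n : Type} [Fintype n] [DecidableEq n] {ρ σ : Matrix n n ℂ}
    {d : ℝ} (hρ : 0 ≤ ρ) (hσ : 0 ≤ σ) (hd : 0 ≤ d) (hρρ : ρ * ρ = ρ)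
    (hσσ : (d : ℂ) • (σ * σ) = σ) (hσρ : (d : ℂ) • (σ * ρ) = ρ) :
    msqrt σ * msqrt ρ = ((1 / Real.sqrt d : ℝ) : ℂ) • ρ := by
  have hsqrt : msqrt σ = (Real.sqrt d : ℂ) • σ := by
    refine msqrt_eq (ofReal_smul_nonneg hσ (Real.sqrt_nonneg d)) ?_
    rw [smul_mul_smul_comm, ← Complex.ofReal_mul, Real.mul_self_sqrt hd, hσσ]
  rw [hsqrt, msqrt_eq hρ hρρ, smul_mul_assoc]
  conv_rhs => rw [← hσρ]
  rw [smul_smul, ← Complex.ofReal_mul, one_div_mul_eq_div, Real.div_sqrt]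

theorem isSimilarity_affinity : IsSimilarity affinity where
  le_one := affinity_le_one
  eq_one_iff := affinity_eq_one_iff
  le_partialTrace := affinity_le_affinity_partialTrace
  blockDiagonal hρ hσ := by
    simp only [affinity, msqrt_blockDiagonal hρ, msqrt_blockDiagonal hσ, ← blockDiagonal_mul,
      trace_blockDiagonal, Complex.re_sum]
  smul hρ hσ hc := by
    rw [affinity, msqrt_smul hρ hc, msqrt_smul hσ hc, smul_mul_smul_comm, ← Complex.ofReal_mul,
      Real.mul_self_sqrt hc, re_trace_ofReal_smul, affinity]
  kronecker hρ hσ hτ := by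
    rw [affinity, msqrt_kronecker hρ hτ.1.nonneg, msqrt_kronecker hσ hτ.1.nonneg,
      ← mul_kronecker_mul, msqrt_mul_self hτ.1.nonneg, trace_kronecker, hτ.2, mul_one, affinity]
  submatrix e hρ hσ := by
    rw [affinity, msqrt_submatrix hρ, msqrt_submatrix hσ, submatrix_mul_equiv,
      trace_submatrix_equiv, affinity]
  inv_sqrt_le hρ hσ hd h := inv_sqrt_le_affinity hρ hσ hd h
  eq_inv_sqrt hρ hσ hd hρρ hσσ hσρ := by
    rw [affinity, trace_mul_comm, msqrt_mul_msqrt_eq_smul hρ.1.nonneg hσ hd hρρ hσσ hσρ,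
      re_trace_ofReal_smul, hρ.2, Complex.one_re, mul_one]

theorem isSimilarity_rootFidelity : IsSimilarity rootFidelity where
  le_one := rootFidelity_le_one
  eq_one_iff := rootFidelity_eq_one_iff
  le_partialTrace := rootFidelity_le_rootFidelity_partialTrace
  blockDiagonal hρ hσ := by
    simp only [rootFidelity, msqrt_blockDiagonal hρ, msqrt_blockDiagonal hσ, ← blockDiagonal_mul,
      mabs_blockDiagonal, trace_blockDiagonal, Complex.re_sum]
  smul hρ hσ hc := by
    rw [rootFidelity, msqrt_smul hρ hc, msqrt_smul hσ hc, smul_mul_smul_comm,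
      ← Complex.ofReal_mul, Real.mul_self_sqrt hc, mabs_smul _ hc, re_trace_ofReal_smul,
      rootFidelity]
  kronecker hρ hσ hτ := by
    rw [rootFidelity, msqrt_kronecker hρ hτ.1.nonneg, msqrt_kronecker hσ hτ.1.nonneg,
      ← mul_kronecker_mul, msqrt_mul_self hτ.1.nonneg, mabs_kronecker,
      mabs_of_nonneg hτ.1.nonneg, trace_kronecker, hτ.2, mul_one, rootFidelity]
  submatrix e hρ hσ := by
    rw [rootFidelity, msqrt_submatrix hρ, msqrt_submatrix hσ, submatrix_mul_equiv,
      mabs_submatrix, trace_submatrix_equiv, rootFidelity]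
  inv_sqrt_le hρ hσ hd h :=
    (inv_sqrt_le_affinity hρ hσ hd h).trans (affinity_le_rootFidelity _ _)
  eq_inv_sqrt hρ hσ hd hρρ hσσ hσρ := by
    rw [rootFidelity, msqrt_mul_msqrt_eq_smul hρ.1.nonneg hσ hd hρρ hσσ hσρ,
      mabs_of_nonneg (ofReal_smul_nonneg hρ.1.nonneg (by positivity)), re_trace_ofReal_smul,
      hρ.2, Complex.one_re, mul_one]

end Similarity

section Pinching

variable {R ι : Type*} [Ring R] [Fintype ι] {e : ι → R}

/-- The pinching `x ↦ ∑ᵢ eᵢ x eᵢ`, the algebraic form of a non-selective measurement. -/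
def pinch [Algebra ℂ R] (e : ι → R) : R →ₗ[ℂ] R := ∑ i, LinearMap.mulLeftRight ℂ (e i, e i)

/-- A resolution of the identity into mutually orthogonal self-adjoint projections. -/
structure IsResolution [StarRing R] (e : ι → R) : Prop extends
    CompleteOrthogonalIdempotents e where
  isSelfAdjoint : ∀ i, IsSelfAdjoint (e i)

theorem IsResolution.map [StarRing R] {S F : Type*} [Ring S] [StarRing S] [FunLike F R S]
    [RingHomClass F R S] [StarHomClass F R S] (he : IsResolution e) (φ : F) :
    IsResolution fun i => φ (e i) where
  toCompleteOrthogonalIdempotents := he.toCompleteOrthogonalIdempotents.map (φ : R →+* S)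
  isSelfAdjoint i := (he.isSelfAdjoint i).map φ

theorem isResolution_of_mul_eq_left [StarRing R] {P Q : R}
    (hP : IsStarProjection P) (hQ : IsStarProjection Q) (h : Q * P = P) :
    IsResolution ![P, Q - P, 1 - Q] := by
  have h' : P * Q = P := by
    simpa only [star_mul, hP.isSelfAdjoint.star_eq, hQ.isSelfAdjoint.star_eq] using congrArg star h
  have hPP := hP.isIdempotentElem.eq
  have hQQ := hQ.isIdempotentElem.eq
  refine { idem := ?_, ortho := ?_, complete := ?_, isSelfAdjoint := ?_ }
  · simp [Fin.forall_fin_succ, IsIdempotentElem, sub_mul, mul_sub, h, h', hPP, hQQ]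
  · simp [Pairwise, Fin.forall_fin_succ, sub_mul, mul_sub, h, h', hPP, hQQ]
  · simp [Fin.sum_univ_succ]
  · simp [Fin.forall_fin_succ, hP.isSelfAdjoint, hQ.isSelfAdjoint, IsSelfAdjoint.sub]

variable [Algebra ℂ R]

theorem pinch_apply (e : ι → R) (x : R) : pinch e x = ∑ i, e i * x * e i := by
  simp only [pinch, LinearMap.sum_apply, LinearMap.mulLeftRight_apply]

theorem mul_pinch (he : OrthogonalIdempotents e) (x : R) (i : ι) :
    e i * pinch e x = e i * x * e i := by
  rw [pinch_apply, Finset.mul_sum, Finset.sum_eq_single i]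
  · rw [← mul_assoc, ← mul_assoc, (he.idem i).eq]
  · intro j _ hj
    rw [mul_assoc, ← mul_assoc, he.ortho hj.symm, zero_mul]
  · simp only [Finset.mem_univ, not_true_eq_false, false_implies]

theorem pinch_mul (he : OrthogonalIdempotents e) (x : R) (i : ι) :
    pinch e x * e i = e i * x * e i := by
  rw [pinch_apply, Finset.sum_mul, Finset.sum_eq_single i]
  · rw [mul_assoc, (he.idem i).eq]
  · intro j _ hj
    rw [mul_assoc, he.ortho hj, mul_zero]
  · simp only [Finset.mem_univ, not_true_eq_false, false_implies]

theorem pinch_pinch (he : OrthogonalIdempotents e) (x : R) :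
    pinch e (pinch e x) = pinch e x := by
  rw [pinch_apply]
  simp only [mul_pinch he, mul_assoc, (he.idem _).eq]
  simp only [← mul_assoc, ← pinch_apply]

theorem pinch_eq_self_iff (he : CompleteOrthogonalIdempotents e) {x : R} :
    pinch e x = x ↔ ∀ i, Commute (e i) x := by
  refine ⟨fun h i => ?_, fun h => ?_⟩
  · rw [← h]
    exact (mul_pinch he.toOrthogonalIdempotents x i).trans
      (pinch_mul he.toOrthogonalIdempotents x i).symm
  · simp only [pinch_apply, (h _).eq, mul_assoc, (he.idem _).eq]
    rw [← Finset.mul_sum, he.complete, mul_one]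

theorem mul_mul_eq_zero_of_commute_sum_smul (he : OrthogonalIdempotents e) {v : ι → ℂ} {x : R}
    (h : Commute (∑ i, v i • e i) x) {i j : ι} (hij : v i ≠ v j) : e i * x * e j = 0 := by
  classical
  have hleft : e i * ∑ k, v k • e k = v i • e i := by
    simp [Finset.mul_sum, he.mul_eq]
  have hright : (∑ k, v k • e k) * e j = v j • e j := by
    simp [Finset.sum_mul, he.mul_eq]
  have hsmul : v i • (e i * x * e j) = v j • (e i * x * e j) := by
    rw [← smul_mul_assoc, ← smul_mul_assoc, ← hleft, mul_assoc (e i), h.eq, ← mul_assoc, mul_assoc,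
      hright, mul_smul_comm]
  have hdiff : (v i - v j) • (e i * x * e j) = 0 := by rw [sub_smul, hsmul, sub_self]
  exact (smul_eq_zero.1 hdiff).resolve_left (sub_ne_zero.2 hij)

theorem commute_sum_smul_iff (he : CompleteOrthogonalIdempotents e) {v : ι → ℂ}
    (hv : Function.Injective v) {x : R} :
    Commute (∑ i, v i • e i) x ↔ ∀ i, Commute (e i) x := by
  refine ⟨fun h => (pinch_eq_self_iff he).1 ?_,
    fun h => Commute.sum_left _ _ _ fun i _ => (h i).smul_left _⟩
  have hdouble : ∑ i, ∑ j, e i * x * e j = x := by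
    simp only [← Finset.mul_sum, ← Finset.sum_mul, he.complete, mul_one, one_mul]
  conv_rhs => rw [← hdouble]
  rw [pinch_apply]
  refine Finset.sum_congr rfl fun i _ => ?_
  rw [Finset.sum_eq_single i]
  · intro j _ hji
    exact mul_mul_eq_zero_of_commute_sum_smul he.toOrthogonalIdempotents h (hv.ne hji.symm)
  · simp only [Finset.mem_univ, not_true_eq_false, false_implies]

end Pinching

section Resolutions

variable {l m n ι : Type*} [Fintype ι]

theorem sum_kronecker {l' : Type*} (M : ι → Matrix l m ℂ) (N : Matrix l' n ℂ) :
    ∑ i, M i ⊗ₖ N = (∑ i, M i) ⊗ₖ N := by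
  ext
  simp only [Matrix.sum_apply, kroneckerMap_apply, Finset.sum_mul]

variable [Fintype n] [DecidableEq n]

theorem isResolution_single : IsResolution fun k : n => Matrix.single k k (1 : ℂ) where
  idem k := by rw [IsIdempotentElem, single_mul_single_same, mul_one]
  ortho k l h := single_mul_single_of_ne _ _ _ _ h _
  complete := by
    ext i j
    simp [Matrix.sum_apply, Matrix.single_apply, one_apply, ite_and]
  isSelfAdjoint k := by simp [IsSelfAdjoint, star_eq_conjTranspose]

theorem IsResolution.kronecker_one [Fintype m] [DecidableEq m] {Q : ι → Matrix n n ℂ}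
    (hQ : IsResolution Q) : IsResolution fun i => Q i ⊗ₖ (1 : Matrix m m ℂ) where
  idem i := by rw [IsIdempotentElem, ← mul_kronecker_mul, (hQ.idem i).eq, Matrix.mul_one]
  ortho i j h := by
    simp only [← mul_kronecker_mul, hQ.ortho h, zero_kronecker]
  complete := by rw [sum_kronecker, hQ.complete, one_kronecker_one]
  isSelfAdjoint i := by
    rw [IsSelfAdjoint, star_eq_conjTranspose, conjTranspose_kronecker, conjTranspose_one,
      ← star_eq_conjTranspose, (hQ.isSelfAdjoint i).star_eq]

theorem trace_pinch {Q : ι → Matrix n n ℂ} (hQ : CompleteOrthogonalIdempotents Q)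
    (M : Matrix n n ℂ) : (pinch Q M).trace = M.trace := by
  have htrace : ∀ i, (Q i * M * Q i).trace = (Q i * M).trace := fun i => by
    rw [trace_mul_comm, ← Matrix.mul_assoc, (hQ.idem i).eq]
  simp only [pinch_apply, trace_sum, htrace]
  rw [← trace_sum, ← Finset.sum_mul, hQ.complete, Matrix.one_mul]

variable {Q : ι → Matrix n n ℂ} (hQ : IsResolution Q) {M : Matrix n n ℂ} (hM : 0 ≤ M)

include hQ hM

theorem pinch_nonneg : 0 ≤ pinch Q M := by
  rw [pinch_apply]
  exact Finset.sum_nonneg fun i _ =>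
    (hQ.isSelfAdjoint i).conjugate_nonneg hM

theorem le_card_smul_pinch : M ≤ ((Fintype.card ι : ℝ) : ℂ) • pinch Q M := by
  have hexpand : ∀ i j, star (Q i - Q j) * M * (Q i - Q j)
      = Q i * M * Q i + Q j * M * Q j - Q i * M * Q j - Q j * M * Q i := fun i j => by
    rw [star_sub, (hQ.isSelfAdjoint i).star_eq, (hQ.isSelfAdjoint j).star_eq]
    noncomm_ring
  have hcross : ∑ i, ∑ j, Q i * M * Q j = M := by
    simp only [← Finset.mul_sum, ← Finset.sum_mul, hQ.complete, Matrix.mul_one, Matrix.one_mul]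
  have hcross' : ∑ i, ∑ j, Q j * M * Q i = M := by rw [Finset.sum_comm, hcross]
  have hsum : ((Fintype.card ι : ℝ) : ℂ) • pinch Q M - M
      = ((1 / 2 : ℝ) : ℂ) • ∑ i, ∑ j, star (Q i - Q j) * M * (Q i - Q j) := by
    simp only [hexpand, Finset.sum_sub_distrib, Finset.sum_add_distrib, hcross, hcross',
      Finset.sum_const, Finset.card_univ, ← Finset.smul_sum, ← pinch_apply]
    rw [← Nat.cast_smul_eq_nsmul ℂ]
    push_cast
    module
  rw [← sub_nonneg, hsum]
  exact ofReal_smul_nonneg (Finset.sum_nonneg fun i _ => Finset.sum_nonneg fun j _ =>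
    star_left_conjugate_nonneg hM _) (by norm_num)

end Resolutions

section SpectralResolution

variable {n : Type*} [Fintype n] [DecidableEq n] {H : Matrix n n ℂ}

/-- The projection onto the eigenspace of a Hermitian matrix for the eigenvalue `x`. It vanishes
when `x` is not an eigenvalue. -/
def spectralProj (H : Matrix n n ℂ) (x : ℝ) : Matrix n n ℂ :=
  cfc (fun y : ℝ => if y = x then (1 : ℝ) else 0) H

theorem commute_spectralProj {M : Matrix n n ℂ} (h : Commute H M) (x : ℝ) :
    Commute (spectralProj H x) M :=
  h.cfc_real _

theorem spectralProj_mul_spectralProj (H : Matrix n n ℂ) (x y : ℝ) :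
    spectralProj H x * spectralProj H y = if x = y then spectralProj H x else 0 := by
  rw [spectralProj, spectralProj, ← cfc_mul _ _ H (H.finite_real_spectrum.continuousOn _)
    (H.finite_real_spectrum.continuousOn _)]
  split_ifs with hxy
  · exact cfc_congr fun z _ => by grind
  · rw [← cfc_const_zero ℝ H]
    exact cfc_congr fun z _ => by grind

theorem cfc_eq_sum_smul_spectralProj [Fintype (spectrum ℝ H)] (g : ℝ → ℝ) :
    cfc g H = ∑ x : spectrum ℝ H, (g x : ℂ) • spectralProj H x := by
  have hcont : ∀ f : ℝ → ℝ, ContinuousOn f (spectrum ℝ H) := H.finite_real_spectrum.continuousOn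
  simp only [spectralProj, Complex.coe_smul, ← cfc_smul _ _ H (hcont _)]
  rw [← cfc_sum_univ _ H fun _ => hcont _]
  refine cfc_congr fun y hy => ?_
  rw [Finset.sum_apply, Finset.sum_eq_single ⟨y, hy⟩]
  · simp
  · intro x _ hxy
    simp [show y ≠ x from fun h => hxy (Subtype.ext h.symm)]
  · simp

variable [Fintype (spectrum ℝ H)] (hH : H.IsHermitian)

include hH

theorem isResolution_spectralProj :
    IsResolution fun x : spectrum ℝ H => spectralProj H x where
  idem x := by rw [IsIdempotentElem, spectralProj_mul_spectralProj, if_pos rfl]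
  ortho x y hxy :=
    (spectralProj_mul_spectralProj H x y).trans (if_neg fun h => hxy (Subtype.ext h))
  complete := by
    have h := cfc_eq_sum_smul_spectralProj (H := H) fun _ => 1
    simpa only [Complex.ofReal_one, one_smul, cfc_const_one ℝ H hH.isSelfAdjoint] using h.symm
  isSelfAdjoint x := cfc_predicate _ H

theorem sum_smul_spectralProj :
    ∑ x : spectrum ℝ H, ((x : ℝ) : ℂ) • spectralProj H x = H := by
  have h := cfc_eq_sum_smul_spectralProj (H := H) id
  simpa only [cfc_id ℝ H hH.isSelfAdjoint, id] using h.symm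

end SpectralResolution

section Observables

variable {a b : Type} [Fintype a] [DecidableEq a] [Fintype b] [DecidableEq b] (A : Observable a)

theorem Observable.proj_eq (k : a) :
    A.proj k = Unitary.conjStarAlgAut ℂ (Matrix a a ℂ) A.basis (Matrix.single k k 1) := by
  ext i j
  simp [Observable.proj, star_eq_conjTranspose, mul_apply, Matrix.single_apply, ite_and]

theorem Observable.isResolution_proj : IsResolution A.proj := by
  simpa only [← A.proj_eq] using
    isResolution_single.map (Unitary.conjStarAlgAut ℂ (Matrix a a ℂ) A.basis)

theorem Observable.trace_proj (k : a) : (A.proj k).trace = 1 := by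
  rw [A.proj_eq, Unitary.conjStarAlgAut_apply, Matrix.trace_mul_cycle, Unitary.coe_star_mul_self,
    Matrix.one_mul, trace_single_eq_same]

theorem Observable.exists_proj_mul_mul_proj_eq_smul (M : Matrix a a ℂ) (k : a) :
    ∃ c : ℂ, A.proj k * M * A.proj k = c • A.proj k := by
  obtain ⟨N, rfl⟩ : ∃ N, Unitary.conjStarAlgAut ℂ (Matrix a a ℂ) A.basis N = M :=
    (Unitary.conjStarAlgAut ℂ (Matrix a a ℂ) A.basis).surjective M
  refine ⟨N k k, ?_⟩
  rw [A.proj_eq, ← map_mul, ← map_mul, single_mul_mul_single, ← map_smul, smul_single, one_mul,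
    mul_one, smul_eq_mul, mul_one]

theorem Observable.isHermitian_toMatrix : A.toMatrix.IsHermitian := by
  rw [IsHermitian, Observable.toMatrix, conjTranspose_sum]
  refine Finset.sum_congr rfl fun k _ => ?_
  rw [conjTranspose_smul, Complex.star_def, Complex.conj_ofReal, ← star_eq_conjTranspose,
    (A.isResolution_proj.isSelfAdjoint k).star_eq]

theorem Observable.commute_toMatrix_iff {M : Matrix a a ℂ} :
    Commute A.toMatrix M ↔ ∀ k, Commute (A.proj k) M :=
  commute_sum_smul_iff A.isResolution_proj.toCompleteOrthogonalIdempotents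
    (Complex.ofReal_injective.comp A.value_injective)

theorem Observable.exists_eq_sum_smul_proj {M : Matrix a a ℂ} (h : Commute A.toMatrix M) :
    ∃ c : a → ℂ, M = ∑ k, c k • A.proj k := by
  choose c hc using A.exists_proj_mul_mul_proj_eq_smul M
  refine ⟨c, ?_⟩
  simp only [← hc, ← pinch_apply]
  exact ((pinch_eq_self_iff A.isResolution_proj.toCompleteOrthogonalIdempotents).2
    (A.commute_toMatrix_iff.1 h)).symm

end Observables

section CommonInvariantSubspaces

variable {a : Type} [Fintype a] [DecidableEq a] {X Y : Observable a}

theorem Observable.eq_smul_one_or_toMatrix_mem_span (hcard : Fintype.card a = 2)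
    {P : Matrix a a ℂ} (hP : Commute X.toMatrix P) :
    (∃ c : ℂ, P = c • 1) ∨ ∃ α β : ℂ, X.toMatrix = α • P + β • 1 := by
  obtain ⟨k, l, hkl, huniv⟩ := Finset.card_eq_two.1 (Finset.card_univ.trans hcard)
  have hsum (g : a → Matrix a a ℂ) : ∑ i, g i = g k + g l := by rw [huniv, Finset.sum_pair hkl]
  have hl : X.proj l = 1 - X.proj k := by
    rw [← X.isResolution_proj.complete, hsum, add_sub_cancel_left]
  obtain ⟨c, hc⟩ := X.exists_eq_sum_smul_proj hP
  rw [hsum, hl] at hc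
  by_cases hcc : c k = c l
  · refine Or.inl ⟨c l, ?_⟩
    rw [hc, hcc]
    module
  · have hne : c k - c l ≠ 0 := sub_ne_zero.2 hcc
    refine Or.inr ⟨(X.value k - X.value l) / (c k - c l),
      X.value l - (X.value k - X.value l) / (c k - c l) * c l, ?_⟩
    rw [Observable.toMatrix, hsum, hl, hc]
    match_scalars <;> field_simp <;> ring

theorem noCommonBlock_of_card_eq_two (hcard : Fintype.card a = 2)
    (hXY : ¬ Commute X.toMatrix Y.toMatrix) : NoCommonBlock X Y := by
  intro P _ hPP hPX hPY
  rcases X.eq_smul_one_or_toMatrix_mem_span hcard hPX.symm with ⟨c, rfl⟩ | ⟨α, β, hX⟩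
  · rw [smul_mul_smul_comm, Matrix.mul_one, ← sub_eq_zero, ← sub_smul] at hPP
    rcases smul_eq_zero.1 hPP with hc | hone
    · rcases mul_eq_zero.1 (show c * (c - 1) = 0 by linear_combination hc) with hc | hc
      · exact Or.inl (by rw [hc, zero_smul])
      · exact Or.inr (by rw [sub_eq_zero.1 hc, one_smul])
    · exact Or.inl (by rw [hone, smul_zero])
  · refine absurd ?_ hXY
    rw [hX]
    exact (hPY.smul_left α).add_left ((Commute.one_left _).smul_left β)

theorem NoCommonBlock.exists_eq_smul_one_of_isHermitian (h : NoCommonBlock X Y) {H : Matrix a a ℂ}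
    (hH : H.IsHermitian) (hX : Commute H X.toMatrix) (hY : Commute H Y.toMatrix) :
    ∃ c : ℂ, H = c • 1 := by
  rcases isEmpty_or_nonempty a
  · exact ⟨0, Subsingleton.elim _ _⟩
  have := Fintype.ofFinite (spectrum ℝ H)
  have hres := isResolution_spectralProj hH
  obtain ⟨x, hx⟩ : ∃ x : spectrum ℝ H, spectralProj H x ≠ 0 := by
    by_contra! hzero
    refine one_ne_zero (α := Matrix a a ℂ) ?_
    rw [← hres.complete, Finset.sum_eq_zero fun x _ => hzero x]
  have hone : spectralProj H x = 1 :=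
    (h _ (hres.isSelfAdjoint x) (hres.idem x) (commute_spectralProj hX x)
      (commute_spectralProj hY x)).resolve_left hx
  refine ⟨(x : ℝ), ?_⟩
  conv_lhs => rw [← sum_smul_spectralProj hH]
  rw [Finset.sum_eq_single x, hone]
  · intro y _ hyx
    rw [← Matrix.mul_one (spectralProj H y), ← hone, hres.ortho hyx, smul_zero]
  · simp only [Finset.mem_univ, not_true_eq_false, false_implies]

theorem NoCommonBlock.exists_eq_smul_one (h : NoCommonBlock X Y) {M : Matrix a a ℂ}
    (hX : Commute M X.toMatrix) (hY : Commute M Y.toMatrix) : ∃ c : ℂ, M = c • 1 := by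
  have hstar {Z : Observable a} (hZ : Commute M Z.toMatrix) : Commute (star M) Z.toMatrix := by
    simpa only [star_eq_conjTranspose, Z.isHermitian_toMatrix.eq] using hZ.star_star
  have hre {Z : Observable a} (hZ : Commute M Z.toMatrix) :
      Commute (realPart M : Matrix a a ℂ) Z.toMatrix := by
    rw [realPart_apply_coe]
    exact (hZ.add_left (hstar hZ)).smul_left _
  have him {Z : Observable a} (hZ : Commute M Z.toMatrix) :
      Commute (imaginaryPart M : Matrix a a ℂ) Z.toMatrix := by
    rw [imaginaryPart_apply_coe]
    exact ((hZ.sub_left (hstar hZ)).smul_left _).smul_left _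
  obtain ⟨c, hc⟩ := h.exists_eq_smul_one_of_isHermitian (realPart M).2 (hre hX) (hre hY)
  obtain ⟨c', hc'⟩ := h.exists_eq_smul_one_of_isHermitian (imaginaryPart M).2 (him hX) (him hY)
  refine ⟨c + Complex.I * c', ?_⟩
  rw [← realPart_add_I_smul_imaginaryPart M, hc, hc', smul_smul, ← add_smul]

end CommonInvariantSubspaces

section Measurement

variable {a b c x : Type}

/-- The block of an operator on `H_A ⊗ H_B` at a pair of basis vectors of `H_B`, as an operator on
`H_A`. Measurements act on each block separately. -/
def slice (ρ : Matrix (a × b) (a × b) ℂ) (i j : b) : Matrix a a ℂ :=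
  ρ.submatrix (fun k => (k, i)) (fun k => (k, j))

theorem slice_ext {ρ σ : Matrix (a × b) (a × b) ℂ}
    (h : ∀ i j, slice ρ i j = slice σ i j) : ρ = σ := by
  ext ⟨k, i⟩ ⟨l, j⟩
  exact congrFun (congrFun (h i j) k) l

variable [Fintype a] [DecidableEq a]

theorem isMixedOnA_iff [Nonempty a] {ρ : Matrix (a × b) (a × b) ℂ} :
    IsMixedOnA ρ ↔ ∀ i j, ∃ c : ℂ, slice ρ i j = c • 1 := by
  have hslice (i j : b) : slice (((Fintype.card a : ℂ)⁻¹ • (1 : Matrix a a ℂ)) ⊗ₖ reducedB ρ) i j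
      = ((Fintype.card a : ℂ)⁻¹ * reducedB ρ i j) • 1 := by
    ext
    simp [slice, mul_right_comm]
  refine ⟨fun h i j => ⟨(Fintype.card a : ℂ)⁻¹ * reducedB ρ i j, ?_⟩,
    fun h => slice_ext fun i j => ?_⟩
  · rw [← hslice, ← show ρ = _ from h]
  · obtain ⟨c, hc⟩ := h i j
    have htrace : reducedB ρ i j = c * Fintype.card a := by
      rw [show reducedB ρ i j = (slice ρ i j).trace from rfl, hc, trace_smul, trace_one,
        smul_eq_mul]
    have hcard : (Fintype.card a : ℂ) ≠ 0 := Nat.cast_ne_zero.2 Fintype.card_ne_zero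
    rw [hslice, hc, htrace, mul_comm c, inv_mul_cancel_left₀ hcard]

variable [Fintype b] [DecidableEq b] [Fintype c] [DecidableEq c] [Fintype x] [DecidableEq x]
  (A : Observable a)

theorem measure_eq_pinch (ρ : Matrix (a × b) (a × b) ℂ) :
    measure A ρ = pinch (fun k => A.proj k ⊗ₖ (1 : Matrix b b ℂ)) ρ :=
  (pinch_apply _ ρ).symm

theorem measure_smul (z : ℂ) (ρ : Matrix (a × b) (a × b) ℂ) :
    measure A (z • ρ) = z • measure A ρ := by
  simp only [measure_eq_pinch, map_smul]

theorem measure_sum {ι : Type*} (s : Finset ι) (ρ : ι → Matrix (a × b) (a × b) ℂ) :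
    measure A (∑ i ∈ s, ρ i) = ∑ i ∈ s, measure A (ρ i) := by
  simp only [measure_eq_pinch, map_sum]

theorem measure_measure (ρ : Matrix (a × b) (a × b) ℂ) :
    measure A (measure A ρ) = measure A ρ := by
  simp only [measure_eq_pinch]
  exact pinch_pinch A.isResolution_proj.kronecker_one.toOrthogonalIdempotents ρ

theorem measure_nonneg {ρ : Matrix (a × b) (a × b) ℂ} (hρ : 0 ≤ ρ) : 0 ≤ measure A ρ := by
  rw [measure_eq_pinch]
  exact pinch_nonneg A.isResolution_proj.kronecker_one hρ

theorem IsState.measure {ρ : Matrix (a × b) (a × b) ℂ} (hρ : IsState ρ) :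
    IsState (measure A ρ) := by
  refine ⟨(measure_nonneg A hρ.1.nonneg).posSemidef, ?_⟩
  rw [measure_eq_pinch,
    trace_pinch A.isResolution_proj.kronecker_one.toCompleteOrthogonalIdempotents, hρ.2]

theorem le_card_smul_measure {ρ : Matrix (a × b) (a × b) ℂ} (hρ : 0 ≤ ρ) :
    ρ ≤ ((Fintype.card a : ℝ) : ℂ) • measure A ρ := by
  rw [measure_eq_pinch]
  exact le_card_smul_pinch A.isResolution_proj.kronecker_one hρ

theorem slice_measure (ρ : Matrix (a × b) (a × b) ℂ) (i j : b) :
    slice (measure A ρ) i j = pinch A.proj (slice ρ i j) := by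
  ext k l
  simp only [slice, measure, pinch_apply, submatrix_apply, Matrix.sum_apply]
  refine Finset.sum_congr rfl fun p _ => ?_
  simp [mul_apply, Fintype.sum_prod_type, one_apply]

theorem measure_eq_self_iff {ρ : Matrix (a × b) (a × b) ℂ} :
    measure A ρ = ρ ↔ ∀ i j, Commute A.toMatrix (slice ρ i j) := by
  simp only [A.commute_toMatrix_iff,
    ← pinch_eq_self_iff A.isResolution_proj.toCompleteOrthogonalIdempotents, ← slice_measure]
  exact ⟨fun h i j => by rw [h], slice_ext⟩

theorem measure_traceOut (ρ : Matrix (a × b × x) (a × b × x) ℂ) :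
    measure A (traceOut ρ) = traceOut (measure A ρ) := by
  have hslice (τ : Matrix (a × b × x) (a × b × x) ℂ) (i j : b) :
      slice (traceOut τ) i j = ∑ k, slice τ (i, k) (j, k) := by
    ext
    simp only [slice, traceOut, submatrix_apply, of_apply, Matrix.sum_apply]
  refine slice_ext fun i j => ?_
  simp only [slice_measure, hslice, map_sum]

theorem measure_adjoin (ρ : Matrix (a × b) (a × b) ℂ) (σ : Matrix c c ℂ) :
    measure A (adjoin ρ σ) = adjoin (measure A ρ) σ := by
  have hslice (τ : Matrix (a × b) (a × b) ℂ) (i j : b × c) :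
      slice (adjoin τ σ) i j = σ i.2 j.2 • slice τ i.1 j.1 := by
    ext
    simp [slice, adjoin, mul_comm]
  refine slice_ext fun i j => ?_
  simp only [slice_measure, hslice, map_smul]

theorem measure_submatrix (ρ : Matrix (a × b) (a × b) ℂ) (e : c ≃ b) :
    measure A (ρ.submatrix (Equiv.prodCongrRight fun _ => e) (Equiv.prodCongrRight fun _ => e))
      = (measure A ρ).submatrix (Equiv.prodCongrRight fun _ => e)
          (Equiv.prodCongrRight fun _ => e) :=
  slice_ext fun i j => (slice_measure A _ i j).trans (slice_measure A ρ (e i) (e j)).symm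

variable [Nonempty a] {ρ : Matrix (a × b) (a × b) ℂ}

theorem IsMixedOnA.measure_eq_self (h : IsMixedOnA ρ) : measure A ρ = ρ := by
  refine (measure_eq_self_iff A).2 fun i j => ?_
  obtain ⟨z, hz⟩ := isMixedOnA_iff.1 h i j
  rw [hz]
  exact (Commute.one_right _).smul_right z

theorem NoCommonBlock.isMixedOnA {X Y : Observable a} (h : NoCommonBlock X Y)
    (hX : measure X ρ = ρ) (hY : measure Y ρ = ρ) : IsMixedOnA ρ :=
  isMixedOnA_iff.2 fun i j => h.exists_eq_smul_one ((measure_eq_self_iff X).1 hX i j).symm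
    ((measure_eq_self_iff Y).1 hY i j).symm

end Measurement

section MaxEntangled

variable {a : Type} [Fintype a] [DecidableEq a]

theorem conjTranspose_maxEntangled : (maxEntangled a)ᴴ = maxEntangled a := by
  ext i j
  simp [maxEntangled, and_comm, apply_ite (starRingEnd ℂ)]

theorem maxEntangled_mul_kronecker_one_mul_maxEntangled (X : Matrix a a ℂ) :
    maxEntangled a * (X ⊗ₖ (1 : Matrix a a ℂ)) * maxEntangled a
      = ((Fintype.card a : ℂ)⁻¹ * X.trace) • maxEntangled a := by
  ext ⟨i, i'⟩ ⟨j, j'⟩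
  simp [maxEntangled, mul_apply, one_apply, Fintype.sum_prod_type, ite_and, trace,
    Finset.mul_sum, Finset.sum_mul]
  split_ifs <;> rfl

theorem maxEntangled_mul_proj_mul_maxEntangled (A : Observable a) (k : a) :
    maxEntangled a * (A.proj k ⊗ₖ (1 : Matrix a a ℂ)) * maxEntangled a
      = (Fintype.card a : ℂ)⁻¹ • maxEntangled a := by
  rw [maxEntangled_mul_kronecker_one_mul_maxEntangled, A.trace_proj, mul_one]

variable [Nonempty a]

theorem maxEntangled_mul_self : maxEntangled a * maxEntangled a = maxEntangled a := by
  have h := maxEntangled_mul_kronecker_one_mul_maxEntangled (1 : Matrix a a ℂ)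
  rwa [one_kronecker_one, Matrix.mul_one, trace_one,
    inv_mul_cancel₀ (Nat.cast_ne_zero.2 Fintype.card_ne_zero), one_smul] at h

theorem isState_maxEntangled : IsState (maxEntangled a) := by
  constructor
  · rw [← maxEntangled_mul_self]
    nth_rw 1 [← conjTranspose_maxEntangled]
    exact posSemidef_conjTranspose_mul_self _
  · simp [maxEntangled, trace, Fintype.sum_prod_type]

variable (A : Observable a)

theorem card_smul_measure_maxEntangled_mul :
    ((Fintype.card a : ℝ) : ℂ) • (measure A (maxEntangled a) * maxEntangled a)
      = maxEntangled a := by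
  have hcard : (Fintype.card a : ℂ) ≠ 0 := Nat.cast_ne_zero.2 Fintype.card_ne_zero
  simp only [measure, Finset.sum_mul, Matrix.mul_assoc]
  simp only [← Matrix.mul_assoc (maxEntangled a), maxEntangled_mul_proj_mul_maxEntangled,
    mul_smul_comm]
  rw [← Finset.smul_sum, ← Finset.sum_mul, A.isResolution_proj.kronecker_one.complete,
    Matrix.one_mul, Complex.ofReal_natCast, smul_inv_smul₀ hcard]

theorem card_smul_measure_maxEntangled_mul_self :
    ((Fintype.card a : ℝ) : ℂ) • (measure A (maxEntangled a) * measure A (maxEntangled a))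
      = measure A (maxEntangled a) := by
  have hcard : (Fintype.card a : ℂ) ≠ 0 := Nat.cast_ne_zero.2 Fintype.card_ne_zero
  set E := fun k => A.proj k ⊗ₖ (1 : Matrix a a ℂ)
  have hE : IsResolution E := A.isResolution_proj.kronecker_one
  have hblock (k : a) : measure A (maxEntangled a) * (E k * maxEntangled a * E k)
      = (Fintype.card a : ℂ)⁻¹ • (E k * maxEntangled a * E k) := by
    calc measure A (maxEntangled a) * (E k * maxEntangled a * E k)
        = E k * (maxEntangled a * E k * maxEntangled a) * E k := by
          rw [measure_eq_pinch, ← Matrix.mul_assoc, ← Matrix.mul_assoc,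
            pinch_mul hE.toOrthogonalIdempotents]
          simp only [Matrix.mul_assoc]
      _ = _ := by
          rw [maxEntangled_mul_proj_mul_maxEntangled, mul_smul_comm, smul_mul_assoc]
  conv_lhs => arg 2; arg 2; rw [measure]
  rw [Finset.mul_sum, Finset.sum_congr rfl fun k _ => hblock k, ← Finset.smul_sum,
    Complex.ofReal_natCast, smul_inv_smul₀ hcard]
  rfl

theorem measure_maxEntangled_ne (hcard : 2 ≤ Fintype.card a) :
    measure A (maxEntangled a) ≠ maxEntangled a := by
  intro h
  have htrace := congrArg trace (card_smul_measure_maxEntangled_mul A)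
  rw [h, maxEntangled_mul_self, trace_smul, isState_maxEntangled.2, smul_eq_mul, mul_one,
    Complex.ofReal_natCast, Nat.cast_eq_one] at htrace
  omega

end MaxEntangled

section States

variable {n m ι : Type} [Fintype n] [Fintype m] [Fintype ι]

theorem IsState.submatrix {σ : Matrix n n ℂ} (hσ : IsState σ) (e : m ≃ n) :
    IsState (σ.submatrix e e) :=
  ⟨hσ.1.submatrix e, by rw [trace_submatrix_equiv, hσ.2]⟩

theorem IsState.adjoin {a b c : Type} [Fintype a] [Fintype b] [Fintype c]
    {ρ : Matrix (a × b) (a × b) ℂ} {σ : Matrix c c ℂ} (hρ : IsState ρ) (hσ : IsState σ) :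
    IsState (adjoin ρ σ) :=
  IsState.submatrix ⟨(kronecker_nonneg hρ.1.nonneg hσ.1.nonneg).posSemidef,
    by rw [trace_kronecker, hρ.2, hσ.2, mul_one]⟩ (Equiv.prodAssoc a b c).symm

theorem traceOut_eq_partialTrace {a b x : Type} [Fintype x]
    (ρ : Matrix (a × b × x) (a × b × x) ℂ) :
    traceOut ρ = partialTrace (ρ.submatrix (Equiv.prodAssoc a b x) (Equiv.prodAssoc a b x)) := by
  ext i j
  rw [partialTrace_apply]
  rfl

theorem IsState.traceOut {a b x : Type} [Fintype a] [Fintype b] [Fintype x]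
    {ρ : Matrix (a × b × x) (a × b × x) ℂ} (hρ : IsState ρ) : IsState (traceOut ρ) := by
  rw [traceOut_eq_partialTrace]
  exact (hρ.submatrix _).partialTrace

theorem isState_sum {p : ι → ℝ} {σ : ι → Matrix n n ℂ} (hp : ∀ i, 0 ≤ p i)
    (hp1 : ∑ i, p i = 1) (hσ : ∀ i, IsState (σ i)) : IsState (∑ i, (p i : ℂ) • σ i) := by
  refine ⟨(Finset.sum_nonneg fun i _ =>
    ofReal_smul_nonneg (hσ i).1.nonneg (hp i)).posSemidef, ?_⟩
  simp only [trace_sum, trace_smul, (hσ _).2, smul_eq_mul, mul_one]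
  exact_mod_cast hp1

variable {a b : Type} [Fintype a] [DecidableEq a] [Fintype b] [DecidableEq b] (A : Observable a)

theorem monitor_eq_sum (ε : ℝ) (ρ : Matrix (a × b) (a × b) ℂ) :
    monitor A ε ρ = ∑ i : Bool, ((cond i (1 - ε) ε : ℝ) : ℂ) • cond i ρ (measure A ρ) := by
  rw [Fintype.sum_bool]
  rfl

theorem measure_monitor (ε : ℝ) (ρ : Matrix (a × b) (a × b) ℂ) :
    measure A (monitor A ε ρ) = measure A ρ := by
  rw [measure_eq_pinch, monitor, map_add, map_smul, map_smul, ← measure_eq_pinch,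
    ← measure_eq_pinch, measure_measure, ← add_smul, ← Complex.ofReal_add, sub_add_cancel,
    Complex.ofReal_one, one_smul]

theorem IsState.monitor {ρ : Matrix (a × b) (a × b) ℂ} (hρ : IsState ρ) {ε : ℝ} (h0 : 0 ≤ ε)
    (h1 : ε ≤ 1) : IsState (monitor A ε ρ) := by
  rw [monitor_eq_sum]
  exact isState_sum (Bool.forall_bool.2 ⟨h0, sub_nonneg.2 h1⟩) (by simp)
    (Bool.forall_bool.2 ⟨hρ.measure A, hρ⟩)

end States

section Monotone

variable {f : ∀ (n : Type) [Fintype n] [DecidableEq n], Matrix n n ℂ → Matrix n n ℂ → ℝ}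

theorem IsSimilarity.sum_mul_le (hf : IsSimilarity f) {n : Type} [Fintype n] [DecidableEq n]
    {ι : Type} [Fintype ι] {p : ι → ℝ} {ρ σ : ι → Matrix n n ℂ} (hp : ∀ i, 0 ≤ p i)
    (hρ : ∀ i, 0 ≤ ρ i) (hσ : ∀ i, 0 ≤ σ i) :
    ∑ i, p i * f n (ρ i) (σ i) ≤ f n (∑ i, (p i : ℂ) • ρ i) (∑ i, (p i : ℂ) • σ i) := by
  classical
  have hpρ (i : ι) : 0 ≤ (p i : ℂ) • ρ i := ofReal_smul_nonneg (hρ i) (hp i)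
  have hpσ (i : ι) : 0 ≤ (p i : ℂ) • σ i := ofReal_smul_nonneg (hσ i) (hp i)
  have h := hf.le_partialTrace (blockDiagonal_nonneg hpρ) (blockDiagonal_nonneg hpσ)
  rw [partialTrace_blockDiagonal, partialTrace_blockDiagonal, hf.blockDiagonal hpρ hpσ] at h
  simpa only [hf.smul (hρ _) (hσ _) (hp _)] using h

variable {a : Type} [Fintype a] [DecidableEq a]

instance : Inhabited (Observable a) where
  default :=
    { basis := 1
      value k := (Fintype.equivFin a k : ℕ)
      value_injective := Nat.cast_injective.comp
        (Fin.val_injective.comp (Fintype.equivFin a).injective) }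

/-- `L` is the loss `d^(-1/2) (2 - 2 f(ρ, Φ_A(ρ)))` attached to the similarity `f`: the common form
of the Bures and of the Hellinger loss. -/
def IsLossOf (L : Quantifier a)
    (f : ∀ (n : Type) [Fintype n] [DecidableEq n], Matrix n n ℂ → Matrix n n ℂ → ℝ) : Prop :=
  ∀ (b : Type) [Fintype b] [DecidableEq b] (A : Observable a) (ρ : Matrix (a × b) (a × b) ℂ),
    IsState ρ → L b A ρ = 1 / Real.sqrt (Fintype.card a) * (2 - 2 * f (a × b) ρ (measure A ρ))

variable {b : Type} [Fintype b] [DecidableEq b] {A : Observable a} {L : Quantifier a}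
  {ρ : Matrix (a × b) (a × b) ℂ} (hL : IsLossOf L f) (hf : IsSimilarity f)
include hL hf

theorem IsLossOf.nonneg (hρ : IsState ρ) : 0 ≤ L b A ρ := by
  rw [hL b A ρ hρ]
  have h := hf.le_one hρ (hρ.measure A)
  exact mul_nonneg (by positivity) (by linarith)

theorem IsLossOf.submatrix (hρ : IsState ρ) {c : Type} [Fintype c] [DecidableEq c] (e : c ≃ b) :
    L c A (ρ.submatrix (Equiv.prodCongrRight fun _ => e) (Equiv.prodCongrRight fun _ => e))
      = L b A ρ := by
  rw [hL c A _ (hρ.submatrix _), hL b A ρ hρ, measure_submatrix,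
    hf.submatrix _ hρ.1.nonneg (measure_nonneg A hρ.1.nonneg)]

theorem IsLossOf.sum_le {ι : Type} [Fintype ι] {p : ι → ℝ}
    {ρ : ι → Matrix (a × b) (a × b) ℂ} (hp : ∀ i, 0 ≤ p i) (hp1 : ∑ i, p i = 1)
    (hρ : ∀ i, IsState (ρ i)) :
    L b A (∑ i, (p i : ℂ) • ρ i) ≤ ∑ i, p i * L b A (ρ i) := by
  have hconcave := hf.sum_mul_le hp (fun i => (hρ i).1.nonneg)
    fun i => measure_nonneg A (hρ i).1.nonneg
  calc L b A (∑ i, (p i : ℂ) • ρ i)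
      = 1 / Real.sqrt (Fintype.card a) * (2 - 2 * f (a × b) (∑ i, (p i : ℂ) • ρ i)
          (∑ i, (p i : ℂ) • measure A (ρ i))) := by
        rw [hL b A _ (isState_sum hp hp1 hρ), measure_sum]
        simp only [measure_smul]
    _ ≤ 1 / Real.sqrt (Fintype.card a)
          * (2 * ∑ i, p i - 2 * ∑ i, p i * f (a × b) (ρ i) (measure A (ρ i))) := by
        rw [hp1, mul_one]
        gcongr
    _ = ∑ i, p i * L b A (ρ i) := by
        simp only [hL b A _ (hρ _), Finset.mul_sum, ← Finset.sum_sub_distrib]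
        exact Finset.sum_congr rfl fun i _ => by ring

theorem IsLossOf.discardAxiom : DiscardAxiom (realism L) := by
  intro b x _ _ _ _ A ρ hρ
  have hle : f (a × b × x) ρ (measure A ρ) ≤ f (a × b) (traceOut ρ) (measure A (traceOut ρ)) := by
    rw [measure_traceOut, traceOut_eq_partialTrace, traceOut_eq_partialTrace,
      ← hf.submatrix (Equiv.prodAssoc a b x) hρ.1.nonneg (measure_nonneg A hρ.1.nonneg)]
    exact hf.le_partialTrace (hρ.1.submatrix _).nonneg
      ((measure_nonneg A hρ.1.nonneg).posSemidef.submatrix _).nonneg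
  simp only [realism, hL _ A _ hρ, hL _ A _ hρ.traceOut]
  gcongr

theorem IsLossOf.uncorrelatedAxiom : UncorrelatedAxiom (realism L) := by
  intro b c _ _ _ _ A ρ σ hρ hσ
  have hm := measure_nonneg A hρ.1.nonneg
  have h : f (a × b × c) (adjoin ρ σ) (adjoin (measure A ρ) σ) = f (a × b) ρ (measure A ρ) := by
    rw [← hf.kronecker hρ.1.nonneg hm hσ]
    exact hf.submatrix (Equiv.prodAssoc a b c).symm (kronecker_nonneg hρ.1.nonneg hσ.1.nonneg)
      (kronecker_nonneg hm hσ.1.nonneg)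
  simp only [realism, hL _ A _ hρ, hL _ A _ (hρ.adjoin hσ), measure_adjoin, h]

theorem IsLossOf.mixingAxiom : MixingAxiom (realism L) := by
  intro b _ _ A ι _ p ρ hp hp1 hρ
  have h := hL.sum_le hf (A := A) hp hp1 hρ
  simp only [realism, mul_sub, Finset.sum_sub_distrib, ← Finset.sum_mul, hp1, one_mul]
  gcongr

variable [Nonempty a]

theorem IsLossOf.eq_zero_iff (hρ : IsState ρ) : L b A ρ = 0 ↔ measure A ρ = ρ := by
  have hd : 1 / Real.sqrt (Fintype.card a) ≠ 0 := by positivity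
  rw [hL b A ρ hρ, ← hf.eq_one_iff hρ (hρ.measure A), mul_eq_zero, or_iff_right hd]
  constructor <;> intro h <;> linarith

theorem IsLossOf.le (hρ : IsState ρ) :
    L b A ρ ≤ 2 / Real.sqrt (Fintype.card a) * (1 - 1 / Real.sqrt (Fintype.card a)) := by
  have h := hf.inv_sqrt_le hρ (measure_nonneg A hρ.1.nonneg) (by positivity)
    (le_card_smul_measure A hρ.1.nonneg)
  calc L b A ρ = 2 / Real.sqrt (Fintype.card a) * (1 - f (a × b) ρ (measure A ρ)) := by
        rw [hL b A ρ hρ]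
        ring
    _ ≤ _ := by gcongr

theorem IsLossOf.maxEntangled : L a A (maxEntangled a)
    = 2 / Real.sqrt (Fintype.card a) * (1 - 1 / Real.sqrt (Fintype.card a)) := by
  have hst : IsState (QRealism.maxEntangled a) := isState_maxEntangled
  rw [hL a A _ hst, hf.eq_inv_sqrt hst (measure_nonneg A hst.1.nonneg) (Nat.cast_nonneg _)
    maxEntangled_mul_self (card_smul_measure_maxEntangled_mul_self A)
    (card_smul_measure_maxEntangled_mul A)]
  ring

theorem IsLossOf.maxRealism_eq : maxRealism L
    = 2 / Real.sqrt (Fintype.card a) * (1 - 1 / Real.sqrt (Fintype.card a)) := by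
  refine IsGreatest.csSup_eq ⟨⟨Fintype.card a, default, _, isState_maxEntangled.submatrix
    (Equiv.prodCongrRight fun _ => (Fintype.equivFin a).symm), ?_⟩, ?_⟩
  · rw [hL.submatrix hf isState_maxEntangled, hL.maxEntangled hf]
  · rintro r ⟨m, A, ρ, hρ, rfl⟩
    exact hL.le hf hρ

theorem IsLossOf.measurementAxiom : MeasurementAxiom (realism L) (maxRealism L) := by
  intro b _ _ A ρ hρ
  have hzero : L b A (measure A ρ) = 0 := (hL.eq_zero_iff hf (hρ.measure A)).2 (measure_measure A ρ)
  refine ⟨fun ε h0 h1 => ?_, by rw [realism, hzero, sub_zero],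
    by rw [realism, sub_eq_self, hL.eq_zero_iff hf hρ]⟩
  have hle : L b A (monitor A ε ρ) ≤ (1 - ε) * L b A ρ := by
    have h := hL.sum_le hf (A := A) (p := (cond · (1 - ε) ε)) (ρ := (cond · ρ (measure A ρ)))
      (Bool.forall_bool.2 ⟨h0, sub_nonneg.2 h1⟩) (by simp)
      (Bool.forall_bool.2 ⟨hρ.measure A, hρ⟩)
    rw [← monitor_eq_sum, Fintype.sum_bool] at h
    simpa only [cond_true, cond_false, hzero, mul_zero, add_zero] using h
  have hmon := hL.nonneg hf (A := A) (hρ.monitor A h0 h1)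
  have hmul : 0 ≤ ε * L b A ρ := mul_nonneg h0 (hL.nonneg hf hρ)
  refine ⟨sub_nonneg.2 ?_, sub_le_sub_left ?_ _, sub_le_sub_left ?_ _⟩
  · rw [hL.maxRealism_eq hf]
    exact hL.le hf hρ
  · linarith
  · rwa [hzero]

theorem IsLossOf.uncertaintyAxiom : UncertaintyAxiom (realism L) (maxRealism L) := by
  intro b _ _ X Y ρ hρ
  have hX := hL.nonneg hf hρ (A := X)
  have hY := hL.nonneg hf hρ (A := Y)
  have hiff : realism L b X ρ + realism L b Y ρ = 2 * maxRealism L ↔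
      measure X ρ = ρ ∧ measure Y ρ = ρ := by
    rw [← hL.eq_zero_iff hf hρ, ← hL.eq_zero_iff hf hρ, realism, realism]
    grind
  refine ⟨by rw [realism, realism]; linarith, hiff,
    fun h => hiff.2 ⟨h.measure_eq_self X, h.measure_eq_self Y⟩, fun h heq => ?_⟩
  obtain ⟨hXρ, hYρ⟩ := hiff.1 heq
  refine or_iff_not_imp_left.2 fun hXY => ?_
  have hblock : NoCommonBlock X Y := h.elim (noCommonBlock_of_card_eq_two · hXY) id
  exact hblock.isMixedOnA hXρ hYρ

theorem IsLossOf.isMonotone : IsMonotone (realism L) (maxRealism L) where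
  measurement := hL.measurementAxiom hf
  discard := hL.discardAxiom hf
  uncorrelated := hL.uncorrelatedAxiom hf
  uncertainty := hL.uncertaintyAxiom hf
  mixing := hL.mixingAxiom hf

end Monotone

section Losses

variable {n : Type} [Fintype n] [DecidableEq n]

theorem schattenNorm_one (M : Matrix n n ℂ) : schattenNorm 1 M = (mabs M).trace.re := by
  have hsa : IsSelfAdjoint (mabs M) := (mabs_nonneg M).isSelfAdjoint
  simp only [schattenNorm, Real.rpow_one, div_one, cfc_id' ℝ (mabs M)]

theorem schattenNorm_two_sq (M : Matrix n n ℂ) : schattenNorm 2 M ^ 2 = (Mᴴ * M).trace.re := by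
  have hsa : IsSelfAdjoint (mabs M) := (mabs_nonneg M).isSelfAdjoint
  have hsq : cfc (fun x : ℝ => x ^ (2 : ℝ)) (mabs M) = Mᴴ * M := by
    simp only [Real.rpow_two]
    rw [cfc_pow_id (mabs M) 2, pow_two, mabs_mul_self]
  rw [schattenNorm, hsq, ← Real.sqrt_eq_rpow,
    Real.sq_sqrt (re_trace_nonneg (conjTranspose_mul_self_nonneg M))]

variable (a : Type) [Fintype a] [DecidableEq a]

theorem isLossOf_lossBures : IsLossOf (lossBures a) rootFidelity := by
  intro b _ _ A ρ hρ
  have hle := rootFidelity_le_one hρ (hρ.measure A)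
  have hfid : fidelity ρ (measure A ρ) = rootFidelity (a × b) ρ (measure A ρ) ^ 2 := by
    rw [fidelity, schattenNorm_one, rootFidelity]
  rw [lossBures, dBures, hfid, Real.sqrt_sq (rootFidelity_nonneg _ _),
    Real.sq_sqrt (by linarith)]

theorem isLossOf_lossHellinger : IsLossOf (lossHellinger a) affinity := by
  intro b _ _ A ρ hρ
  rw [lossHellinger, dHellinger, schattenNorm_two_sq, re_trace_msqrt_sub_sq hρ (hρ.measure A)]

end Losses

section SpectralCalculus

variable {n ι : Type*} [Fintype n] [DecidableEq n] [Fintype ι]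

theorem mul_cfc_eq_smul {H Q : Matrix n n ℂ} (hH : H.IsHermitian) {c : ℝ}
    (h : Q * H = (c : ℂ) • Q) (g : ℝ → ℝ) : Q * cfc g H = (g c : ℂ) • Q := by
  have := Fintype.ofFinite (spectrum ℝ H)
  have hP : IsResolution fun x : spectrum ℝ H => spectralProj H x := isResolution_spectralProj hH
  have hmul (x : spectrum ℝ H) : H * spectralProj H x = ((x : ℝ) : ℂ) • spectralProj H x := by
    nth_rw 1 [← sum_smul_spectralProj hH]
    simp [Finset.sum_mul, hP.mul_eq]
  have hzero (x : spectrum ℝ H) (hx : (x : ℝ) ≠ c) : Q * spectralProj H x = 0 := by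
    have hcx : (c : ℂ) • (Q * spectralProj H x) = ((x : ℝ) : ℂ) • (Q * spectralProj H x) := by
      rw [← smul_mul_assoc, ← h, Matrix.mul_assoc, hmul, mul_smul_comm]
    rw [← sub_eq_zero, ← sub_smul, smul_eq_zero, sub_eq_zero, Complex.ofReal_inj] at hcx
    exact hcx.resolve_left hx.symm
  calc Q * cfc g H = ∑ x : spectrum ℝ H, (g c : ℂ) • (Q * spectralProj H x) := by
        rw [cfc_eq_sum_smul_spectralProj, Finset.mul_sum]
        refine Finset.sum_congr rfl fun x _ => ?_
        rw [mul_smul_comm]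
        by_cases hx : (x : ℝ) = c
        · rw [hx]
        · rw [hzero x hx, smul_zero, smul_zero]
    _ = (g c : ℂ) • Q := by
        rw [← Finset.smul_sum, ← Finset.mul_sum, hP.complete, Matrix.mul_one]

variable {Q : ι → Matrix n n ℂ} (hQ : IsResolution Q)
include hQ

theorem IsResolution.isHermitian_sum_smul (c : ι → ℝ) :
    (∑ i, (c i : ℂ) • Q i).IsHermitian := by
  rw [IsHermitian, conjTranspose_sum]
  refine Finset.sum_congr rfl fun i _ => ?_
  rw [conjTranspose_smul, ← star_eq_conjTranspose, (hQ.isSelfAdjoint i).star_eq,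
    Complex.star_def, Complex.conj_ofReal]

theorem IsResolution.cfc_sum_smul (c : ι → ℝ) (g : ℝ → ℝ) :
    cfc g (∑ i, (c i : ℂ) • Q i) = ∑ i, (g (c i) : ℂ) • Q i := by
  have hmul (i : ι) : Q i * ∑ j, (c j : ℂ) • Q j = (c i : ℂ) • Q i := by
    classical
    simp [Finset.mul_sum, hQ.mul_eq]
  rw [← Matrix.one_mul (cfc g _), ← hQ.complete, Finset.sum_mul]
  exact Finset.sum_congr rfl fun i _ => mul_cfc_eq_smul (hQ.isHermitian_sum_smul c) (hmul i) g

theorem IsResolution.submatrix {m : Type*} [Fintype m] [DecidableEq m] (e : m ≃ n) :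
    IsResolution fun i => (Q i).submatrix e e where
  idem i := by rw [IsIdempotentElem, submatrix_mul_equiv, (hQ.idem i).eq]
  ortho i j h := by
    simp only [submatrix_mul_equiv, hQ.ortho h, submatrix_zero, Pi.zero_apply]
  complete := by
    rw [← submatrix_one_equiv e, ← hQ.complete]
    ext
    simp only [Matrix.sum_apply, submatrix_apply]
  isSelfAdjoint i := by
    rw [IsSelfAdjoint, star_eq_conjTranspose, conjTranspose_submatrix, ← star_eq_conjTranspose,
      (hQ.isSelfAdjoint i).star_eq]

omit hQ in
theorem cfc_submatrix {m : Type*} [Fintype m] [DecidableEq m] {H : Matrix n n ℂ}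
    (hH : H.IsHermitian) (g : ℝ → ℝ) (e : m ≃ n) :
    cfc g (H.submatrix e e) = (cfc g H).submatrix e e := by
  have := Fintype.ofFinite (spectrum ℝ H)
  have hsub (c : spectrum ℝ H → ℝ) :
      (∑ x : spectrum ℝ H, (c x : ℂ) • spectralProj H x).submatrix e e
        = ∑ x : spectrum ℝ H, (c x : ℂ) • (spectralProj H x).submatrix e e := by
    ext
    simp only [Matrix.sum_apply, submatrix_apply, Matrix.smul_apply]
  nth_rw 1 [← sum_smul_spectralProj hH]
  rw [hsub, ((isResolution_spectralProj hH).submatrix e).cfc_sum_smul,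
    cfc_eq_sum_smul_spectralProj, hsub fun x => g x]

omit hQ [Fintype n] [DecidableEq n] in
theorem sum_smul_kronecker_sum_smul {m κ : Type*} [Fintype κ] (Q : ι → Matrix n n ℂ)
    (R : κ → Matrix m m ℂ) (c : ι → ℂ) (d : κ → ℂ) :
    (∑ i, c i • Q i) ⊗ₖ (∑ j, d j • R j) = ∑ i : ι × κ, (c i.1 * d i.2) • Q i.1 ⊗ₖ R i.2 := by
  ext
  simp only [Fintype.sum_prod_type, Matrix.sum_apply, kroneckerMap_apply, Finset.sum_mul_sum,
    Matrix.smul_apply, smul_eq_mul, mul_mul_mul_comm]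

theorem IsResolution.kronecker {m κ : Type*} [Fintype m] [DecidableEq m] [Fintype κ]
    {R : κ → Matrix m m ℂ} (hR : IsResolution R) :
    IsResolution fun i : ι × κ => Q i.1 ⊗ₖ R i.2 where
  idem i := by rw [IsIdempotentElem, ← mul_kronecker_mul, (hQ.idem _).eq, (hR.idem _).eq]
  ortho i j h := by
    beta_reduce
    rw [← mul_kronecker_mul]
    by_cases h₁ : i.1 = j.1
    · rw [hR.ortho fun h₂ => h (Prod.ext h₁ h₂), kronecker_zero]
    · rw [hQ.ortho h₁, zero_kronecker]
  complete := by
    rw [← one_kronecker_one, ← hQ.complete, ← hR.complete]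
    ext
    simp only [Fintype.sum_prod_type, Matrix.sum_apply, kroneckerMap_apply, Finset.sum_mul_sum]
  isSelfAdjoint i := by
    rw [IsSelfAdjoint, star_eq_conjTranspose, conjTranspose_kronecker, ← star_eq_conjTranspose,
      ← star_eq_conjTranspose, (hQ.isSelfAdjoint _).star_eq, (hR.isSelfAdjoint _).star_eq]

omit hQ in
theorem cfc_rpow_kronecker {m : Type*} [Fintype m] [DecidableEq m] {M : Matrix m m ℂ}
    {N : Matrix n n ℂ} (hM : 0 ≤ M) (hN : 0 ≤ N) (p : ℝ) :
    cfc (fun x : ℝ => x ^ p) (M ⊗ₖ N)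
      = cfc (fun x : ℝ => x ^ p) M ⊗ₖ cfc (fun x : ℝ => x ^ p) N := by
  have := Fintype.ofFinite (spectrum ℝ M)
  have := Fintype.ofFinite (spectrum ℝ N)
  have hM' := hM.posSemidef.isHermitian
  have hN' := hN.posSemidef.isHermitian
  have hMN : M ⊗ₖ N = ∑ x : spectrum ℝ M × spectrum ℝ N,
      ((x.1 * x.2 : ℝ) : ℂ) • spectralProj M x.1 ⊗ₖ spectralProj N x.2 := by
    nth_rw 1 [← sum_smul_spectralProj hM', ← sum_smul_spectralProj hN']
    simp only [sum_smul_kronecker_sum_smul, Complex.ofReal_mul]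
  rw [cfc_eq_sum_smul_spectralProj (H := M), cfc_eq_sum_smul_spectralProj (H := N),
    sum_smul_kronecker_sum_smul, hMN,
    ((isResolution_spectralProj hM').kronecker (isResolution_spectralProj hN')).cfc_sum_smul]
  refine Finset.sum_congr rfl fun x _ => ?_
  rw [Real.mul_rpow (spectrum_nonneg_of_nonneg hM x.1.2) (spectrum_nonneg_of_nonneg hN x.2.2),
    Complex.ofReal_mul]

end SpectralCalculus

section SchattenNorm

variable {m n : Type} [Fintype m] [DecidableEq m] [Fintype n] [DecidableEq n] {p : ℝ}

theorem mabs_eq_cfc_abs {H : Matrix n n ℂ} (hH : H.IsHermitian) :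
    mabs H = cfc (fun x : ℝ => |x|) H := by
  have hsa : IsSelfAdjoint H := hH
  refine mabs_eq (cfc_nonneg fun x _ => abs_nonneg x) ?_
  rw [← cfc_mul _ _ H, hH.eq]
  simp only [abs_mul_abs_self]
  rw [cfc_mul (fun x => x) (fun x => x) H, cfc_id' ℝ H]

theorem cfc_rpow_mabs_nonneg (p : ℝ) (M : Matrix n n ℂ) :
    0 ≤ cfc (fun x : ℝ => x ^ p) (mabs M) :=
  cfc_nonneg fun _ hx => Real.rpow_nonneg (spectrum_nonneg_of_nonneg (mabs_nonneg M) hx) p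

theorem schattenNorm_nonneg (p : ℝ) (M : Matrix n n ℂ) : 0 ≤ schattenNorm p M :=
  Real.rpow_nonneg (re_trace_nonneg (cfc_rpow_mabs_nonneg p M)) _

theorem schattenNorm_rpow (hp : 0 < p) (M : Matrix n n ℂ) :
    schattenNorm p M ^ p = (cfc (fun x : ℝ => x ^ p) (mabs M)).trace.re := by
  rw [schattenNorm, one_div,
    Real.rpow_inv_rpow (re_trace_nonneg (cfc_rpow_mabs_nonneg p M)) hp.ne']

theorem IsResolution.schattenNorm_sum_smul_rpow {ι : Type*} [Fintype ι] {Q : ι → Matrix n n ℂ}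
    (hQ : IsResolution Q) (hp : 0 < p) (c : ι → ℝ) :
    schattenNorm p (∑ i, (c i : ℂ) • Q i) ^ p = ∑ i, |c i| ^ p * (Q i).trace.re := by
  rw [schattenNorm_rpow hp, mabs_eq_cfc_abs (hQ.isHermitian_sum_smul c), hQ.cfc_sum_smul,
    hQ.cfc_sum_smul, trace_sum, Complex.re_sum]
  simp only [re_trace_ofReal_smul]

theorem schattenNorm_submatrix (p : ℝ) (M : Matrix n n ℂ) (e : m ≃ n) :
    schattenNorm p (M.submatrix e e) = schattenNorm p M := by
  rw [schattenNorm, mabs_submatrix, cfc_submatrix (mabs_nonneg M).posSemidef.isHermitian,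
    trace_submatrix_equiv, schattenNorm]

theorem schattenNorm_kronecker (p : ℝ) (M : Matrix m m ℂ) (N : Matrix n n ℂ) :
    schattenNorm p (M ⊗ₖ N) = schattenNorm p M * schattenNorm p N := by
  have htrace {k : Type} [Fintype k] [DecidableEq k] (K : Matrix k k ℂ) :
      0 ≤ (cfc (fun x : ℝ => x ^ p) (mabs K)).trace :=
    (cfc_rpow_mabs_nonneg p K).posSemidef.trace_nonneg
  rw [schattenNorm, mabs_kronecker, cfc_rpow_kronecker (mabs_nonneg M) (mabs_nonneg N),
    trace_kronecker, Complex.mul_re, ← (Complex.le_def.1 (htrace M)).2, Complex.zero_im, zero_mul,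
    sub_zero, Real.mul_rpow (Complex.le_def.1 (htrace M)).1 (Complex.le_def.1 (htrace N)).1,
    schattenNorm, schattenNorm]

theorem IsResolution.dSchatten_kronecker_rpow {ι : Type*} [Fintype ι]
    {Q : ι → Matrix n n ℂ} (hQ : IsResolution Q) (hp : 0 < p) (x y : ι → ℝ) (e₀ : m) (t : ℝ) :
    dSchatten p ((∑ i, (x i : ℂ) • Q i) ⊗ₖ Matrix.single e₀ e₀ (1 : ℂ))
        ((∑ i, (y i : ℂ) • Q i) ⊗ₖ ((t : ℂ) • (1 : Matrix m m ℂ))) ^ p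
      = ∑ i, (|t * y i - x i| ^ p + (Fintype.card m - 1) * |t * y i| ^ p) * (Q i).trace.re := by
  have hone : (t : ℂ) • (1 : Matrix m m ℂ) = ∑ j, (t : ℂ) • Matrix.single j j (1 : ℂ) := by
    rw [← Finset.smul_sum, isResolution_single.complete]
  have hsingle : Matrix.single e₀ e₀ (1 : ℂ)
      = ∑ j, (if j = e₀ then (1 : ℂ) else 0) • Matrix.single j j (1 : ℂ) := by
    simp
  have hsub : (∑ i, (y i : ℂ) • Q i) ⊗ₖ ((t : ℂ) • (1 : Matrix m m ℂ))
        - (∑ i, (x i : ℂ) • Q i) ⊗ₖ Matrix.single e₀ e₀ (1 : ℂ)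
      = ∑ i : ι × m, ((t * y i.1 - if i.2 = e₀ then x i.1 else 0 : ℝ) : ℂ) •
          Q i.1 ⊗ₖ Matrix.single i.2 i.2 (1 : ℂ) := by
    rw [hone, hsingle, sum_smul_kronecker_sum_smul, sum_smul_kronecker_sum_smul,
      ← Finset.sum_sub_distrib]
    refine Finset.sum_congr rfl fun i _ => ?_
    rw [← sub_smul]
    congr 1
    split_ifs <;> push_cast <;> ring
  rw [dSchatten, hsub, (hQ.kronecker isResolution_single).schattenNorm_sum_smul_rpow hp,
    Fintype.sum_prod_type]
  refine Finset.sum_congr rfl fun i _ => ?_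
  have hrest (j : m) (hj : j ∈ Finset.univ.erase e₀) :
      |t * y i - if j = e₀ then x i else 0| ^ p = |t * y i| ^ p := by
    rw [if_neg (Finset.ne_of_mem_erase hj), sub_zero]
  simp only [trace_kronecker, trace_single_eq_same, mul_one, ← Finset.sum_mul]
  rw [← Finset.add_sum_erase _ _ (Finset.mem_univ e₀), Finset.sum_congr rfl hrest, if_pos rfl,
    Finset.sum_const, Finset.card_erase_of_mem (Finset.mem_univ e₀), Finset.card_univ, nsmul_eq_mul,
    Nat.cast_pred (Fintype.card_pos_iff.2 ⟨e₀⟩)]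

end SchattenNorm

section Profile

variable {d p : ℝ}

theorem not_contDiffAt_abs_rpow (hp : 1 < p) (hp2 : p < 2) :
    ¬ ContDiffAt ℝ 2 (fun x : ℝ => |x| ^ p) 0 := by
  intro h
  have hderiv : deriv (fun x : ℝ => |x| ^ p) = fun x => p * |x| ^ (p - 2) * x :=
    funext fun x => (hasDerivAt_abs_rpow x hp).deriv
  have hdiff : DifferentiableAt ℝ (deriv fun x : ℝ => |x| ^ p) 0 :=
    (h.fderiv_right (m := 1) (by norm_num)).differentiableAt one_ne_zero |>.clm_apply
      (differentiableAt_const 1)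
  have hslope := hdiff.hasDerivAt.tendsto_slope_zero_right
  refine not_tendsto_nhds_of_tendsto_atTop ?_ _ hslope
  refine ((tendsto_rpow_neg_nhdsGT_zero (sub_neg.2 hp2)).const_mul_atTop
    (zero_lt_one.trans hp)).congr' ?_
  filter_upwards [self_mem_nhdsWithin] with x hx
  have hx' : 0 < x := hx
  simp only [hderiv, zero_add, mul_zero, sub_zero, smul_eq_mul, abs_of_pos hx']
  field_simp

/-- The `p`-th power of the Schatten `p`-norm of `|e₀⟩⟨e₀| - 1/d`. -/
def schattenWeight (d p : ℝ) : ℝ := (1 - d⁻¹) ^ p + (d - 1) * d⁻¹ ^ p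

/-- The loss `lossSchatten` of the monitored maximally entangled state that has the eigenvalue `α`
on the range of its measured version away from the maximally entangled vector. -/
def schattenProfile (d p α : ℝ) : ℝ :=
  |d⁻¹ ^ 2 - (1 - (d - 1) * α)| ^ p + (d - 1) * |d⁻¹ ^ 2 - α| ^ p + (d - 1) * d * (d⁻¹ ^ 2) ^ p
    - schattenWeight d p * ((1 - (d - 1) * α) ^ p + (d - 1) * α ^ p)

theorem one_sub_rpow_add_le {u : ℝ} (hp : 2 ≤ p) (hu0 : 0 < u) (hu : u ≤ 1 / 2) :
    (1 - u) ^ p + u ^ (p - 1) * (1 - u) ≤ (1 - u ^ 2) ^ p := by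
  have hu1 : 0 < 1 - u := by linarith
  have hpow : u ^ (p - 1) * (1 - u) ≤ (1 - u) ^ p * (p * u) :=
    calc u ^ (p - 1) * (1 - u) = u ^ (p - 2) * (u * (1 - u)) := by
          rw [show p - 1 = p - 2 + 1 by ring, Real.rpow_add_one hu0.ne']
          ring
      _ ≤ (1 - u) ^ (p - 2) * (u * (1 - u) * (p * (1 - u))) := by
          refine mul_le_mul (Real.rpow_le_rpow hu0.le (by linarith) (by linarith))
            (le_mul_of_one_le_right (by positivity) ?_) (by positivity) (by positivity)
          nlinarith
      _ = (1 - u) ^ p * (p * u) := by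
          rw [show p = p - 2 + 2 by ring, Real.rpow_add hu1, Real.rpow_two]
          ring_nf
  calc (1 - u) ^ p + u ^ (p - 1) * (1 - u) ≤ (1 - u) ^ p * (1 + p * u) := by linarith
    _ ≤ (1 - u) ^ p * (1 + u) ^ p := by
        gcongr
        exact one_add_mul_self_le_rpow_one_add (by linarith) (by linarith)
    _ = (1 - u ^ 2) ^ p := by
        rw [← Real.mul_rpow hu1.le (by linarith)]
        ring_nf

theorem schattenProfile_zero_pos (hd : 2 ≤ d) (hp : 2 ≤ p) : 0 < schattenProfile d p 0 := by
  have hd0 : 0 < d := by linarith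
  have hu : d⁻¹ ≤ 1 / 2 := by simpa using inv_anti₀ two_pos hd
  have hweight : schattenWeight d p ≤ (1 - d⁻¹ ^ 2) ^ p := by
    refine le_of_eq_of_le ?_ (one_sub_rpow_add_le hp (inv_pos.2 hd0) hu)
    rw [schattenWeight, Real.rpow_sub_one (inv_ne_zero hd0.ne')]
    field_simp
  have habs : |d⁻¹ ^ 2 - 1| = 1 - d⁻¹ ^ 2 := by
    rw [abs_sub_comm, abs_of_nonneg (by nlinarith [inv_pos.2 hd0])]
  have hpos : 0 < (d⁻¹ ^ 2) ^ p := by positivity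
  simp only [schattenProfile, mul_zero, sub_zero, Real.zero_rpow (by linarith : p ≠ 0),
    Real.one_rpow, add_zero, mul_one, habs, abs_of_pos (pow_pos (inv_pos.2 hd0) 2)]
  have h1 : 0 < (d - 1) * (d⁻¹ ^ 2) ^ p := mul_pos (by linarith) hpos
  have h2 : 0 < (d - 1) * d * (d⁻¹ ^ 2) ^ p := by
    rw [mul_right_comm]
    exact mul_pos h1 hd0
  linarith

-- The other terms are smooth at `α = d⁻²`, where `|d⁻² - α| ^ p` is not twice differentiable.
theorem contDiffAt_schattenProfile_sub (hd : 2 ≤ d) :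
    ContDiffAt ℝ 2 (fun α => schattenProfile d p α - (d - 1) * |d⁻¹ ^ 2 - α| ^ p) (d⁻¹ ^ 2) := by
  have hu0 : 0 < d⁻¹ := by positivity
  have hu : d⁻¹ ≤ 1 / 2 := by simpa using inv_anti₀ two_pos hd
  have hξ : 1 - (d - 1) * d⁻¹ ^ 2 = 1 - d⁻¹ + d⁻¹ ^ 2 := by
    field_simp
    ring
  have hξ0 : 1 - (d - 1) * d⁻¹ ^ 2 ≠ 0 := by
    rw [hξ]
    nlinarith
  have hdiff : d⁻¹ ^ 2 - (1 - (d - 1) * d⁻¹ ^ 2) ≠ 0 := by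
    rw [hξ]
    linarith
  have hsmooth : ContDiffAt ℝ 2 (fun α : ℝ => |d⁻¹ ^ 2 - (1 - (d - 1) * α)| ^ p
      + (d - 1) * d * (d⁻¹ ^ 2) ^ p
      - schattenWeight d p * ((1 - (d - 1) * α) ^ p + (d - 1) * α ^ p)) (d⁻¹ ^ 2) := by
    have hlin : ContDiffAt ℝ 2 (fun α : ℝ => 1 - (d - 1) * α) (d⁻¹ ^ 2) := by fun_prop
    have habs := ((contDiffAt_const.sub hlin).abs hdiff).rpow_const_of_ne (p := p)
      (abs_ne_zero.2 hdiff)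
    have hpow := hlin.rpow_const_of_ne (p := p) hξ0
    have hid := contDiffAt_id.rpow_const_of_ne (n := 2) (p := p) (pow_pos hu0 2).ne'
    exact (habs.add contDiffAt_const).sub
      (contDiffAt_const.mul (hpow.add (contDiffAt_const.mul hid)))
  refine hsmooth.congr_of_eventuallyEq (.of_forall fun α => ?_)
  simp only [schattenProfile]
  ring

theorem not_forall_schattenProfile_eq_zero (hd : 2 ≤ d) (hp : 1 < p) (hp2 : p < 2) :
    ¬ ∀ α : ℝ, 0 ≤ α → α ≤ d⁻¹ → schattenProfile d p α = 0 := by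
  intro hzero
  have hu0 : 0 < d⁻¹ := by positivity
  have hu : d⁻¹ ≤ 1 / 2 := by simpa using inv_anti₀ two_pos hd
  have hd1 : d - 1 ≠ 0 := by linarith
  have hshift : ContDiffAt ℝ 2 (fun x : ℝ => d⁻¹ ^ 2 + x) 0 := by fun_prop
  have hcomp := ContDiffAt.comp (x := (0 : ℝ))
    (g := fun α => schattenProfile d p α - (d - 1) * |d⁻¹ ^ 2 - α| ^ p) (f := fun x => d⁻¹ ^ 2 + x)
    (by simpa only [add_zero] using contDiffAt_schattenProfile_sub hd) hshift
  refine not_contDiffAt_abs_rpow hp hp2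
    ((contDiffAt_const (c := -(d - 1)⁻¹)).mul hcomp |>.congr_of_eventuallyEq ?_)
  filter_upwards [Ioo_mem_nhds (neg_lt_zero.2 (pow_pos hu0 2)) (pow_pos hu0 2)] with x hx
  have hα : d⁻¹ ^ 2 + x ≤ d⁻¹ := by nlinarith [hx.2]
  simp only [Function.comp_apply, hzero _ (by linarith [hx.1]) hα,
    sub_add_cancel_left, abs_neg]
  field_simp
  ring

theorem exists_schattenProfile_ne_zero (hd : 2 ≤ d) (hp : 1 < p) :
    ∃ α : ℝ, 0 ≤ α ∧ α ≤ d⁻¹ ∧ schattenProfile d p α ≠ 0 := by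
  rcases le_or_gt 2 p with hp2 | hp2
  · exact ⟨0, le_rfl, by positivity, (schattenProfile_zero_pos hd hp2).ne'⟩
  · by_contra! hzero
    exact not_forall_schattenProfile_eq_zero hd hp hp2 hzero

end Profile

section Violations

variable {a b c k : Type} [Fintype a] [DecidableEq a] [Fintype b] [DecidableEq b]
  [Fintype c] [DecidableEq c] [Fintype k] [DecidableEq k] {A : Observable a} {p : ℝ}

theorem measure_monitor_eq_self_iff {ε : ℝ} (hε : ε ≠ 1) {ρ : Matrix (a × b) (a × b) ℂ} :
    measure A (monitor A ε ρ) = monitor A ε ρ ↔ measure A ρ = ρ := by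
  have hsub : measure A ρ - monitor A ε ρ = ((1 - ε : ℝ) : ℂ) • (measure A ρ - ρ) := by
    rw [monitor]
    push_cast
    module
  have hne : ((1 - ε : ℝ) : ℂ) ≠ 0 := Complex.ofReal_ne_zero.2 (sub_ne_zero.2 hε.symm)
  rw [measure_monitor, ← sub_eq_zero, hsub, smul_eq_zero_iff_right hne, sub_eq_zero]

theorem lossTrace_eq_zero [Nonempty a] {ρ : Matrix (a × b) (a × b) ℂ} (hρ : IsState ρ)
    (h : (Fintype.card a : ℂ)⁻¹ • measure A ρ ≤ ρ) : lossTrace a b A ρ = 0 := by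
  have hcard : (Fintype.card a : ℝ) ≠ 0 := Nat.cast_ne_zero.2 Fintype.card_ne_zero
  have hcast : (Fintype.card a : ℂ)⁻¹ = (((Fintype.card a : ℝ)⁻¹ : ℝ) : ℂ) := by push_cast; rfl
  rw [lossTrace, dSchatten, schattenNorm_one, ← neg_sub ρ, mabs_neg,
    mabs_of_nonneg (sub_nonneg.2 h), trace_sub, Complex.sub_re, hρ.2, hcast, re_trace_ofReal_smul,
    (hρ.measure A).2, Complex.one_re]
  field_simp
  ring

theorem not_measurementAxiom_lossTrace (hcard : 2 ≤ Fintype.card a) :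
    ¬ MeasurementAxiom (realism (lossTrace a)) (maxRealism (lossTrace a)) := by
  intro h
  have : Nonempty a := Fintype.card_pos_iff.1 (by omega)
  have hd : (2 : ℝ) ≤ Fintype.card a := by exact_mod_cast hcard
  set A : Observable a := default
  set ε : ℝ := (Fintype.card a : ℝ)⁻¹ with hε
  have hε1 : ε < 1 := inv_lt_one_of_one_lt₀ (by linarith)
  have hP := isState_maxEntangled (a := a)
  have hρ := hP.monitor A (by positivity : 0 ≤ ε) hε1.le
  have hloss : lossTrace a a A (monitor A ε (maxEntangled a)) = 0 := by
    refine lossTrace_eq_zero hρ ?_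
    rw [measure_monitor, monitor, hε, Complex.ofReal_inv, Complex.ofReal_natCast]
    exact le_add_of_nonneg_left (ofReal_smul_nonneg hP.1.nonneg (by linarith))
  have hfix := (h a A _ hρ).2.2.1 (by rw [realism, hloss, sub_zero])
  exact measure_maxEntangled_ne A hcard ((measure_monitor_eq_self_iff hε1.ne).1 hfix)

theorem UncorrelatedAxiom.eq_zero_of_mul {L : Quantifier a} (h : UncorrelatedAxiom (realism L))
    {ρ : Matrix (a × b) (a × b) ℂ} {σ : Matrix c c ℂ} (hρ : IsState ρ) (hσ : IsState σ) {w : ℝ}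
    (hw : w ≠ 1) (hL : L (b × c) A (adjoin ρ σ) = w * L b A ρ) : L b A ρ = 0 := by
  have heq := h b c A ρ σ hρ hσ
  rw [realism, realism, sub_right_inj, hL] at heq
  exact (mul_left_eq_self₀.1 heq).resolve_left hw

variable (c) in
theorem isState_inv_card_smul_one [Nonempty c] :
    IsState ((Fintype.card c : ℂ)⁻¹ • (1 : Matrix c c ℂ)) := by
  refine ⟨PosSemidef.one.smul (by positivity), ?_⟩
  rw [trace_smul, trace_one, smul_eq_mul,
    inv_mul_cancel₀ (Nat.cast_ne_zero.2 Fintype.card_ne_zero)]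

theorem schattenNorm_inv_card_smul_one_rpow_lt_one (hcard : 2 ≤ Fintype.card c) (hp : 1 < p) :
    schattenNorm p ((Fintype.card c : ℂ)⁻¹ • (1 : Matrix c c ℂ)) ^ p < 1 := by
  have hd : (2 : ℝ) ≤ Fintype.card c := by exact_mod_cast hcard
  have hsum : (Fintype.card c : ℂ)⁻¹ • (1 : Matrix c c ℂ)
      = ∑ i : c, (((Fintype.card c : ℝ)⁻¹ : ℝ) : ℂ) • Matrix.single i i (1 : ℂ) := by
    rw [← Finset.smul_sum, isResolution_single.complete]
    push_cast
    rfl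
  calc schattenNorm p ((Fintype.card c : ℂ)⁻¹ • (1 : Matrix c c ℂ)) ^ p
      = Fintype.card c * (Fintype.card c : ℝ)⁻¹ ^ p := by
        rw [hsum, isResolution_single.schattenNorm_sum_smul_rpow (by linarith)]
        simp
    _ < Fintype.card c * (Fintype.card c : ℝ)⁻¹ := by
        gcongr
        exact Real.rpow_lt_self_of_lt_one (by positivity) (inv_lt_one_of_one_lt₀ (by linarith)) hp
    _ = 1 := mul_inv_cancel₀ (by linarith)

variable {ρ τ : Matrix (a × b) (a × b) ℂ}

theorem dSchatten_adjoin (σ : Matrix c c ℂ) :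
    dSchatten p (adjoin ρ σ) (adjoin τ σ) = schattenNorm p σ * dSchatten p ρ τ := by
  have hsub : adjoin τ σ - adjoin ρ σ
      = ((τ - ρ) ⊗ₖ σ).submatrix (Equiv.prodAssoc a b c).symm (Equiv.prodAssoc a b c).symm := by
    ext
    simp [adjoin, sub_mul]
  rw [dSchatten, hsub, schattenNorm_submatrix, schattenNorm_kronecker, mul_comm, dSchatten]

theorem dSchatten_adjoin_kronecker (σ : Matrix c c ℂ) (M N : Matrix k k ℂ) :
    dSchatten p (adjoin ρ σ ⊗ₖ M) (adjoin τ σ ⊗ₖ N)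
      = schattenNorm p σ * dSchatten p (ρ ⊗ₖ M) (τ ⊗ₖ N) := by
  let e : (a × b × c) × k ≃ ((a × b) × k) × c :=
    ⟨fun i => (((i.1.1, i.1.2.1), i.2), i.1.2.2), fun i => ((i.1.1.1, i.1.1.2, i.2), i.1.2),
      fun _ => rfl, fun _ => rfl⟩
  have hsub : adjoin τ σ ⊗ₖ N - adjoin ρ σ ⊗ₖ M
      = ((τ ⊗ₖ N - ρ ⊗ₖ M) ⊗ₖ σ).submatrix e e := by
    ext
    simp [adjoin, e]
    ring
  rw [dSchatten, hsub, schattenNorm_submatrix, schattenNorm_kronecker, mul_comm, dSchatten]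

theorem lossHilbertSchmidt_adjoin (σ : Matrix c c ℂ) :
    lossHilbertSchmidt a (b × c) A (adjoin ρ σ)
      = schattenNorm 2 σ ^ 2 * lossHilbertSchmidt a b A ρ := by
  rw [lossHilbertSchmidt, measure_adjoin, dSchatten_adjoin, lossHilbertSchmidt]
  ring

theorem lossSchatten_adjoin (e₀ : a) (σ : Matrix c c ℂ) :
    lossSchatten a p e₀ (b × c) A (adjoin ρ σ)
      = schattenNorm p σ ^ p * lossSchatten a p e₀ b A ρ := by
  have hmul (M : Matrix ((a × b) × a) ((a × b) × a) ℂ) :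
      (schattenNorm p σ * schattenNorm p M) ^ p = schattenNorm p σ ^ p * schattenNorm p M ^ p :=
    Real.mul_rpow (schattenNorm_nonneg p σ) (schattenNorm_nonneg p M)
  rw [lossSchatten, measure_adjoin, dSchatten_adjoin_kronecker, dSchatten_adjoin_kronecker,
    dSchatten, dSchatten, hmul, hmul, ← mul_sub, lossSchatten, dSchatten, dSchatten]

theorem measure_eq_self_of_lossHilbertSchmidt_eq_zero [Nonempty a]
    (h : lossHilbertSchmidt a b A ρ = 0) : measure A ρ = ρ := by
  rw [lossHilbertSchmidt, dSchatten, schattenNorm_two_sq, mul_eq_zero,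
    or_iff_right (by positivity)] at h
  exact sub_eq_zero.1 (conjTranspose_mul_self_eq_zero.1
    (eq_zero_of_re_trace_eq_zero (conjTranspose_mul_self_nonneg _) h))

theorem not_uncorrelatedAxiom_lossHilbertSchmidt (hcard : 2 ≤ Fintype.card a) :
    ¬ UncorrelatedAxiom (realism (lossHilbertSchmidt a)) := by
  intro h
  have : Nonempty a := Fintype.card_pos_iff.1 (by omega)
  have hw := schattenNorm_inv_card_smul_one_rpow_lt_one hcard one_lt_two
  rw [Real.rpow_two] at hw
  exact measure_maxEntangled_ne default hcard (measure_eq_self_of_lossHilbertSchmidt_eq_zero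
    (h.eq_zero_of_mul isState_maxEntangled (isState_inv_card_smul_one a) hw.ne
      (lossHilbertSchmidt_adjoin _)))

theorem lossSchatten_sum_smul {ι : Type*} [Fintype ι] {Q : ι → Matrix (a × b) (a × b) ℂ}
    (hQ : IsResolution Q) (hp : 0 < p) {x y : ι → ℝ} (hx : ∀ i, 0 ≤ x i)
    (hρ : ρ = ∑ i, (x i : ℂ) • Q i) (hm : measure A ρ = ∑ i, (y i : ℂ) • Q i) (e₀ : a) :
    lossSchatten a p e₀ b A ρ = ∑ i, (|(Fintype.card a : ℝ)⁻¹ * y i - x i| ^ p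
      + (Fintype.card a - 1) * |(Fintype.card a : ℝ)⁻¹ * y i| ^ p
      - schattenWeight (Fintype.card a) p * x i ^ p) * (Q i).trace.re := by
  have : Nonempty a := ⟨e₀⟩
  have hd : (1 : ℝ) ≤ Fintype.card a := Nat.one_le_cast.2 Fintype.card_pos
  have hinv : (Fintype.card a : ℝ)⁻¹ ≤ 1 := inv_le_one_of_one_le₀ hd
  have hweight (i : ι) : |(Fintype.card a : ℝ)⁻¹ * x i - x i| ^ p
      + (Fintype.card a - 1) * |(Fintype.card a : ℝ)⁻¹ * x i| ^ p
      = schattenWeight (Fintype.card a) p * x i ^ p := by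
    have habs : |(Fintype.card a : ℝ)⁻¹ * x i - x i| = (1 - (Fintype.card a : ℝ)⁻¹) * x i := by
      rw [abs_sub_comm, abs_of_nonneg] <;> nlinarith [hx i]
    rw [habs, abs_of_nonneg (mul_nonneg (by positivity) (hx i)), Real.mul_rpow (by linarith) (hx i),
      Real.mul_rpow (by positivity) (hx i), schattenWeight]
    ring
  have hcast : (Fintype.card a : ℂ)⁻¹ = (((Fintype.card a : ℝ)⁻¹ : ℝ) : ℂ) := by push_cast; rfl
  rw [lossSchatten, hm, hρ, hcast, hQ.dSchatten_kronecker_rpow hp, hQ.dSchatten_kronecker_rpow hp,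
    ← Finset.sum_sub_distrib]
  simp only [hweight, ← sub_mul]

variable (A) in
theorem isResolution_maxEntangled [Nonempty a] :
    IsResolution ![maxEntangled a,
      ((Fintype.card a : ℝ) : ℂ) • measure A (maxEntangled a) - maxEntangled a,
      1 - ((Fintype.card a : ℝ) : ℂ) • measure A (maxEntangled a)] := by
  refine isResolution_of_mul_eq_left
    ⟨maxEntangled_mul_self, isState_maxEntangled.1.isHermitian⟩ ⟨?_, ?_⟩ ?_
  · rw [IsIdempotentElem, smul_mul_smul_comm, mul_smul, card_smul_measure_maxEntangled_mul_self]
  · exact (ofReal_smul_nonneg (measure_nonneg A isState_maxEntangled.1.nonneg)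
      (Nat.cast_nonneg _)).isSelfAdjoint
  · rw [smul_mul_assoc, card_smul_measure_maxEntangled_mul]

variable (A) in
theorem lossSchatten_monitor_maxEntangled (hp : 0 < p) (e₀ : a) {α : ℝ} (h0 : 0 ≤ α)
    (h1 : α ≤ (Fintype.card a : ℝ)⁻¹) :
    lossSchatten a p e₀ a A (monitor A (Fintype.card a * α) (maxEntangled a))
      = schattenProfile (Fintype.card a) p α := by
  have : Nonempty a := ⟨e₀⟩
  set d : ℝ := (Fintype.card a : ℝ)
  have hd0 : d ≠ 0 := Nat.cast_ne_zero.2 Fintype.card_ne_zero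
  set P := maxEntangled a
  set M := measure A P
  have hx : ∀ i, 0 ≤ ![1 - (d - 1) * α, α, 0] i := by
    have hdα : d * α ≤ 1 := (mul_le_mul_of_nonneg_left h1 (Nat.cast_nonneg _)).trans mul_inv_le_one
    simp only [Fin.forall_fin_succ, cons_val_zero, cons_val_succ, Fin.forall_fin_zero, le_refl]
    exact ⟨by linarith, h0, trivial, trivial⟩
  have hρ : monitor A (d * α) P = ∑ i, ((![1 - (d - 1) * α, α, 0] i : ℝ) : ℂ) •
      ![P, (d : ℂ) • M - P, 1 - (d : ℂ) • M] i := by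
    simp only [monitor, Fin.sum_univ_three, cons_val]
    push_cast
    module
  have hm : measure A (monitor A (d * α) P) = ∑ i, ((![d⁻¹, d⁻¹, 0] i : ℝ) : ℂ) •
      ![P, (d : ℂ) • M - P, 1 - (d : ℂ) • M] i := by
    simp only [measure_monitor, Fin.sum_univ_three, cons_val]
    rw [← smul_add, add_sub_cancel, Complex.ofReal_inv,
      inv_smul_smul₀ (Complex.ofReal_ne_zero.2 hd0), Complex.ofReal_zero, zero_smul, add_zero]
  have htrP : P.trace.re = 1 := by rw [isState_maxEntangled.2, Complex.one_re]
  have htrM : M.trace.re = 1 := by rw [(isState_maxEntangled.measure A).2, Complex.one_re]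
  have habs : |d⁻¹ ^ 2| = d⁻¹ ^ 2 := abs_sq _
  refine (lossSchatten_sum_smul (isResolution_maxEntangled A) hp hx hρ hm e₀).trans ?_
  change ∑ i : Fin 3, (|d⁻¹ * ![d⁻¹, d⁻¹, 0] i - ![1 - (d - 1) * α, α, 0] i| ^ p
    + (d - 1) * |d⁻¹ * ![d⁻¹, d⁻¹, 0] i| ^ p
    - schattenWeight d p * ![1 - (d - 1) * α, α, 0] i ^ p)
      * (![P, (d : ℂ) • M - P, 1 - (d : ℂ) • M] i).trace.re = schattenProfile d p α
  simp only [Fin.sum_univ_three, cons_val, trace_sub, Complex.sub_re, re_trace_ofReal_smul, htrP,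
    htrM, ← sq, habs, mul_zero, sub_zero, abs_zero, Real.zero_rpow hp.ne', add_zero, zero_mul,
    schattenProfile]
  ring

theorem not_uncorrelatedAxiom_lossSchatten (hcard : 2 ≤ Fintype.card a) (hp : 1 < p) (e₀ : a) :
    ¬ UncorrelatedAxiom (realism (lossSchatten a p e₀)) := by
  intro h
  have : Nonempty a := ⟨e₀⟩
  obtain ⟨α, h0, h1, hα⟩ := exists_schattenProfile_ne_zero (by exact_mod_cast hcard :
    (2 : ℝ) ≤ Fintype.card a) hp
  have hρ : IsState (monitor default (Fintype.card a * α) (maxEntangled a)) :=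
    isState_maxEntangled.monitor default (by positivity) <|
      (mul_le_mul_of_nonneg_left h1 (Nat.cast_nonneg _)).trans mul_inv_le_one
  refine hα ((lossSchatten_monitor_maxEntangled default (by linarith) e₀ h0 h1).symm.trans ?_)
  exact h.eq_zero_of_mul hρ (isState_inv_card_smul_one a)
    (schattenNorm_inv_card_smul_one_rpow_lt_one hcard hp).ne (lossSchatten_adjoin e₀ _)

end Violations

end

end QRealism

open QRealism in
theorem mainTheorem1 (a : Type) [Fintype a] [DecidableEq a] [Nonempty a] :
    -- the Bures and the Hellinger quantifiers are monotones
    IsMonotone (realism (lossBures a)) (maxRealism (lossBures a)) ∧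
    IsMonotone (realism (lossHellinger a)) (maxRealism (lossHellinger a)) ∧
    -- the maximum is explicit, and it is the loss of the maximally entangled state
    maxRealism (lossBures a) =
      2 / Real.sqrt (Fintype.card a) * (1 - 1 / Real.sqrt (Fintype.card a)) ∧
    maxRealism (lossHellinger a) =
      2 / Real.sqrt (Fintype.card a) * (1 - 1 / Real.sqrt (Fintype.card a)) ∧
    (∀ A : Observable a, maxRealism (lossBures a) = lossBures a a A (maxEntangled a)) ∧
    (∀ A : Observable a, maxRealism (lossHellinger a) = lossHellinger a a A (maxEntangled a)) ∧
    -- the quantifiers of the other distances are not monotones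
    (2 ≤ Fintype.card a →
      ¬ MeasurementAxiom (realism (lossTrace a)) (maxRealism (lossTrace a)) ∧
      ¬ UncorrelatedAxiom (realism (lossHilbertSchmidt a)) ∧
      ∀ p : ℝ, 1 < p → p ≠ 2 → ∀ e₀ : a,
        ¬ UncorrelatedAxiom (realism (lossSchatten a p e₀))) := by
  have hB := isLossOf_lossBures a
  have hH := isLossOf_lossHellinger a
  have fB := isSimilarity_rootFidelity
  have fH := isSimilarity_affinity
  refine ⟨hB.isMonotone fB, hH.isMonotone fH, hB.maxRealism_eq fB, hH.maxRealism_eq fH,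
    fun A => ?_, fun A => ?_, fun hd => ⟨not_measurementAxiom_lossTrace hd,
      not_uncorrelatedAxiom_lossHilbertSchmidt hd,
      fun p hp _ e₀ => not_uncorrelatedAxiom_lossSchatten hd hp e₀⟩⟩
  · rw [hB.maxRealism_eq fB, hB.maxEntangled fB]
  · rw [hH.maxRealism_eq fH, hH.maxEntangled fH]
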